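/- Consider $N=m_1+m_2$ bosonic modes on $L^2(\mathbb{R}^N)$ with quadratures $R=(q_1,\dots,q_N,p_1,\dots,p_N)$, $q_j=x_j$, $p_j=-i\partial_j$, $[q_j,p_k]=i\delta_{jk}$, and Hamiltonian $H=\frac12\sum_{j=1}^N(q_j^2+p_j^2)$. A pure state $\rho=|\psi\rangle\langle\psi|$, $\|\psi\|=1$, is Gaussian if its characteristic function has the form $\operatorname{Tr}(\rho\, e^{i\xi\cdot R})=\exp\!\big(i\,\xi\cdot d-\tfrac14\,\xi^{T}C\,\xi\big)$, $\xi\in\mathbb{R}^{2N}$, with a real vector $d$ and a real matrix $C$; its covariance matrix is $\Sigma_{kl}=\langle R_kR_l+R_lR_k\rangle-2\langle R_k\rangle\langle R_l\rangle$. A unitary $U$ is Gaussian if $U^\dagger RU=SR+s$ with $S$ a real symplectic matrix and $s\in\mathbb{R}^{2N}$, in the sense that $U^\dagger e^{i\xi\cdot R}U=e^{i\xi\cdot(SR+s)}$ for all $\xi$. Let the modes be bipartitioned into $\mathcal{A}_1$ ($m_1$ modes) and $\mathcal{A}_2$ ($m_2$ modes), and put $$\mathcal{E}_G(\rho)=\operatorname{Tr}(\rho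 H)-\min_{U}\operatorname{Tr}(U\rho U^\dagger H),\qquad \mathcal{E}_{2\text{-loc}}^{\mathcal{A}_1|\mathcal{A}_2}(\rho)=\operatorname{Tr}(\rho H)-\min_{U_1\otimes U_2}\operatorname{Tr}\big((U_1\otimes U_2)\rho(U_1\otimes U_2)^\dagger H\big),$$ where $U$ runs over the Gaussian unitaries of all $N$ modes and $U_i$ over the Gaussian unitaries of the modes in $\mathcal{A}_i$. The 2-local ergotropic gap is $\delta^{\mathcal{A}_1|\mathcal{A}_2}_{2\text{-loc}}(\rho)=\mathcal{E}_G(\rho)-\mathcal{E}_{2\text{-loc}}^{\mathcal{A}_1|\mathcal{A}_2}(\rho)$. The symplectic eigenvalues of a real symmetric positive definite $2m\times 2m$ matrix $C$ are the numbers $\nu_1,\dots,\nu_m>0$ (with multiplicity) such that $SCS^{T}=\operatorname{diag}(\nu_1,\dots,\nu_m,\nu_1,\dots,\nu_m)$ for some symplectic $S$ (coordinates ordered as $q_1,\dots,q_m,p_1,\dots,p_m$). Lemma. Let $\rho$ be a pure Gaussian state of $m_1+m_2$ modes with $m_1\le m_2$. Then $\operatorname{Tr}(\rho H)$ is finite,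 both minima are attained, the reduced covariance matrix of $\mathcal{A}_1$ (the block of $\Sigma$ belonging to the quadratures of $\mathcal{A}_1$) has symplectic eigenvalues $\nu_1^{\mathcal{A}_1},\dots,\nu_{m_1}^{\mathcal{A}_1}$, and $$\delta^{\mathcal{A}_1|\mathcal{A}_2}_{2\text{-loc}}(\rho)=\sum_{i=1}^{m_1}\big(\nu_i^{\mathcal{A}_1}-1\big).$$ -/

import Mathlib

open MeasureTheory Matrix
open scoped ENNReal

noncomputable section

namespace CV

/-- The Hilbert space `L²(ℝ^ι)` of a system of bosonic modes labelled by `ι`. -/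
abbrev Hilb (ι : Type*) [Fintype ι] : Type _ :=
  Lp ℂ 2 (volume : Measure (ι → ℝ))

/-- Vectors of the phase space of the modes `ι`: the coordinate `Sum.inl i` belongs to the
position `q_i`, the coordinate `Sum.inr i` to the momentum `p_i`. -/
abbrev Phase (ι : Type*) : Type _ := ι ⊕ ι → ℝ

section OneSystem

variable {ι : Type*} [Fintype ι]

/-- The position part of a phase space vector. -/
def posPart (ξ : Phase ι) : ι → ℝ := fun i => ξ (Sum.inl i)

/-- The momentum part of a phase space vector. -/
def momPart (ξ : Phase ι) : ι → ℝ := fun i => ξ (Sum.inr i)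

/-- For `ξ = (a, b)`, the function `x ↦ exp (i (a·x + a·b/2)) ψ(x + b)`. -/
def weylFun (ξ : Phase ι) (ψ : (ι → ℝ) → ℂ) (x : ι → ℝ) : ℂ :=
  Complex.exp (Complex.I *
      ((posPart ξ ⬝ᵥ x + (posPart ξ ⬝ᵥ momPart ξ) / 2 : ℝ) : ℂ)) * ψ (x + momPart ξ)

theorem memLp_weylFun (ξ : Phase ι) (ψ : Hilb ι) : MemLp (weylFun ξ ψ) 2 volume := by
  have h1 : MemLp (fun x => ψ (x + momPart ξ)) 2 (volume : Measure (ι → ℝ)) :=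
    (Lp.memLp ψ).comp_measurePreserving (measurePreserving_add_right volume (momPart ξ))
  have hc : Continuous fun x : ι → ℝ => Complex.exp (Complex.I *
      ((posPart ξ ⬝ᵥ x + (posPart ξ ⬝ᵥ momPart ξ) / 2 : ℝ) : ℂ)) := by
    have : Continuous fun x : ι → ℝ => posPart ξ ⬝ᵥ x :=
      continuous_const.dotProduct continuous_id
    fun_prop
  refine h1.of_le (hc.aestronglyMeasurable.mul h1.1) (Filter.Eventually.of_forall fun x => ?_)
  have : ‖Complex.exp (Complex.I *
      ((posPart ξ ⬝ᵥ x + (posPart ξ ⬝ᵥ momPart ξ) / 2 : ℝ) : ℂ))‖ = 1 := by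
    rw [mul_comm]; exact Complex.norm_exp_ofReal_mul_I _
  rw [weylFun, norm_mul, this, one_mul]

/-- The Weyl operator `W(ξ) = exp (i ξ·R)`, where `R` is the vector of the quadratures
`q_j` (multiplication by `x_j`) and `p_j = -i ∂/∂x_j`, so that `[q_j, p_k] = i δ_{jk}`. By
`exp (i (a·q + b·p)) = exp (i a·b/2) exp (i a·q) exp (i b·p)` it acts on wave functions as in
`weylFun`. -/
def weyl (ξ : Phase ι) (ψ : Hilb ι) : Hilb ι := (memLp_weylFun ξ ψ).toLp (weylFun ξ ψ)

variable [DecidableEq ι]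

/-- The coordinate vector of phase space with label `k`, so that `weyl (t • basisVec k)` is
`exp (i t R_k)`. -/
def basisVec (k : ι ⊕ ι) : Phase ι := Pi.single k 1

/-- `ψ` lies in the domain of the self-adjoint operator `R_k`, the generator of the unitary group
`t ↦ exp (i t R_k)` in the sense of Stone: this orbit of `ψ` is differentiable in norm. -/
def InDomain (k : ι ⊕ ι) (ψ : Hilb ι) : Prop :=
  DifferentiableAt ℝ (fun t : ℝ => weyl (t • basisVec k) ψ) 0

/-- The vector `R_k ψ` for `ψ` in the domain of the quadrature `R_k`. -/
def quad (k : ι ⊕ ι) (ψ : Hilb ι) : Hilb ι :=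
  (-Complex.I) • deriv (fun t : ℝ => weyl (t • basisVec k) ψ) 0

open Classical in
/-- The mean energy `⟨ψ, H ψ⟩` for `H = (1/2) ∑_j (q_j² + p_j²)`, as the value of the closed
quadratic form of `H`; it is infinite outside the form domain. -/
def energy (ψ : Hilb ι) : ℝ≥0∞ :=
  if ∀ k, InDomain k ψ then ENNReal.ofReal ((1 / 2) * ∑ k : ι ⊕ ι, ‖quad k ψ‖ ^ 2) else ⊤

/-- The first moments `⟨R_k⟩` in the state `|ψ⟩⟨ψ|`. -/
def firstMoment (ψ : Hilb ι) (k : ι ⊕ ι) : ℝ := (inner ℂ ψ (quad k ψ)).re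

/-- The covariance matrix `⟨R_k R_l + R_l R_k⟩ - 2 ⟨R_k⟩ ⟨R_l⟩` of the state `|ψ⟩⟨ψ|`. -/
def covMatrix (ψ : Hilb ι) : Matrix (ι ⊕ ι) (ι ⊕ ι) ℝ :=
  Matrix.of fun k l =>
    (inner ℂ (quad k ψ) (quad l ψ) + inner ℂ (quad l ψ) (quad k ψ)).re
      - 2 * firstMoment ψ k * firstMoment ψ l

/-- `|ψ⟩⟨ψ|` is a (pure) Gaussian state: `ψ` is a unit vector and the characteristic function
`ξ ↦ Tr (|ψ⟩⟨ψ| W(ξ))` is Gaussian. -/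
def IsPureGaussian (ψ : Hilb ι) : Prop :=
  ‖ψ‖ = 1 ∧ ∃ (d : Phase ι) (C : Matrix (ι ⊕ ι) (ι ⊕ ι) ℝ), ∀ ξ : Phase ι,
    inner ℂ ψ (weyl ξ ψ) =
      Complex.exp (Complex.I * ((ξ ⬝ᵥ d : ℝ) : ℂ) - ((ξ ⬝ᵥ (C *ᵥ ξ) : ℝ) : ℂ) / 4)

/-- Gaussian unitaries: in the Heisenberg picture they act on the quadratures by an affine
symplectic map, `U† R U = S R + s`; in exponentiated form,
`U† exp (i ξ·R) U = exp (i ξ·(S R + s))`. -/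
def IsGaussianUnitary (U : Hilb ι ≃ₗᵢ[ℂ] Hilb ι) : Prop :=
  ∃ S ∈ symplecticGroup ι ℝ, ∃ s : Phase ι, ∀ (ξ : Phase ι) (ψ : Hilb ι),
    U.symm (weyl ξ (U ψ)) =
      Complex.exp (Complex.I * ((ξ ⬝ᵥ s : ℝ) : ℂ)) • weyl (Sᵀ *ᵥ ξ) ψ

/-- `ν` lists the symplectic eigenvalues (with multiplicity) of `C`: `C` has the Williamson
normal form `diag (ν, ν)` under symplectic congruence. -/
def IsSymplecticSpectrum (C : Matrix (ι ⊕ ι) (ι ⊕ ι) ℝ) (ν : ι → ℝ) : Prop :=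
  (∀ i, 0 < ν i) ∧
    ∃ S ∈ symplecticGroup ι ℝ, S * C * Sᵀ = Matrix.diagonal (Sum.elim ν ν)

/-- The global Gaussian ergotropy `Tr (ρ H) - min_U Tr (U ρ U† H)` of `ρ = |ψ⟩⟨ψ|`. -/
def globalErgotropy (ψ : Hilb ι) : ℝ :=
  (energy ψ).toReal -
    (⨅ (U : Hilb ι ≃ₗᵢ[ℂ] Hilb ι) (_ : IsGaussianUnitary U), energy (U ψ)).toReal

end OneSystem

section TwoSystems

variable {ι κ : Type*} [Fintype ι] [Fintype κ]

/-- The product wave function `(x, y) ↦ f(x) g(y)`. -/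
def tensorFun (f : (ι → ℝ) → ℂ) (g : (κ → ℝ) → ℂ) (x : ι ⊕ κ → ℝ) : ℂ :=
  f (fun i => x (Sum.inl i)) * g (fun j => x (Sum.inr j))

theorem memLp_tensorFun (f : Hilb ι) (g : Hilb κ) : MemLp (tensorFun f g) 2 volume := by
  have hmp := volume_measurePreserving_sumPiEquivProdPi (fun _ : ι ⊕ κ => ℝ)
  have hf := Lp.memLp f
  have hg := Lp.memLp g
  have h : MemLp (fun z : (ι → ℝ) × (κ → ℝ) => f z.1 * g z.2) 2
      ((volume : Measure (ι → ℝ)).prod (volume : Measure (κ → ℝ))) := by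
    have hm : AEStronglyMeasurable (fun z : (ι → ℝ) × (κ → ℝ) => f z.1 * g z.2)
        ((volume : Measure (ι → ℝ)).prod (volume : Measure (κ → ℝ))) :=
      (hf.1.comp_fst).mul (hg.1.comp_snd)
    rw [memLp_two_iff_integrable_sq_norm hm]
    have := ((memLp_two_iff_integrable_sq_norm hf.1).1 hf).mul_prod
      ((memLp_two_iff_integrable_sq_norm hg.1).1 hg)
    refine this.congr (Filter.Eventually.of_forall fun z => ?_)
    simp only [norm_mul, mul_pow]
  exact h.comp_measurePreserving hmp

/-- The product vector `f ⊗ g` in `L²(ℝ^ι × ℝ^κ) = L²(ℝ^ι) ⊗ L²(ℝ^κ)`. -/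
def tensor (f : Hilb ι) (g : Hilb κ) : Hilb (ι ⊕ κ) :=
  (memLp_tensorFun f g).toLp (tensorFun f g)

variable [DecidableEq ι] [DecidableEq κ]

/-- Local Gaussian unitaries `U = U₁ ⊗ U₂` for the bipartition of the modes into `ι` and `κ`. -/
def IsLocalGaussianUnitary (U : Hilb (ι ⊕ κ) ≃ₗᵢ[ℂ] Hilb (ι ⊕ κ)) : Prop :=
  ∃ (U₁ : Hilb ι ≃ₗᵢ[ℂ] Hilb ι) (U₂ : Hilb κ ≃ₗᵢ[ℂ] Hilb κ),
    IsGaussianUnitary U₁ ∧ IsGaussianUnitary U₂ ∧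
      ∀ (f : Hilb ι) (g : Hilb κ), U (tensor f g) = tensor (U₁ f) (U₂ g)

/-- The 2-local Gaussian ergotropy `Tr (ρ H) - min_{U₁ ⊗ U₂} Tr (U ρ U† H)` of `ρ = |ψ⟩⟨ψ|`. -/
def localErgotropy (ψ : Hilb (ι ⊕ κ)) : ℝ :=
  (energy ψ).toReal -
    (⨅ (U : Hilb (ι ⊕ κ) ≃ₗᵢ[ℂ] Hilb (ι ⊕ κ)) (_ : IsLocalGaussianUnitary U),
      energy (U ψ)).toReal

/-- The 2-local ergotropic gap. -/
def ergotropicGap (ψ : Hilb (ι ⊕ κ)) : ℝ := globalErgotropy ψ - localErgotropy ψ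

/-- The reduced covariance matrix of the first subsystem: the block of the entries that belong to
the quadratures of the modes in `ι`. -/
def reducedCov (C : Matrix ((ι ⊕ κ) ⊕ (ι ⊕ κ)) ((ι ⊕ κ) ⊕ (ι ⊕ κ)) ℝ) :
    Matrix (ι ⊕ ι) (ι ⊕ ι) ℝ :=
  C.submatrix (Sum.map Sum.inl Sum.inl) (Sum.map Sum.inl Sum.inl)

end TwoSystems

end CV

end

/-!
A pure Gaussian vector with characteristic function `exp (i ξ·d - ξᵀ C ξ / 4)` lies in the domain
of every quadrature, has covariance matrix `C`, and its energy is `tr C / 4 + |d|² / 2`. A Gaussian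
unitary acts by `C ↦ S C Sᵀ`, `d ↦ S d + s`, and every affine symplectic map is implemented by one.
So minimising the energy means `d ↦ 0` and minimising `tr (S C Sᵀ)`, which by Williamson's theorem
has minimum `2 ∑ νᵢ`. For local unitaries `S` is block diagonal and only the two reduced covariance
matrices enter, so the local minimum is `½ (∑ νᵢ + ∑ μⱼ)` with their symplectic eigenvalues.

Williamson's theorem holds because a minimiser of `tr (S C Sᵀ)` over the symplectic group makes the
matrix commute with `J`, that is, complex Hermitian, and a unitary diagonalises it.

Purity is used through the wave function: `ψ̄(y - b/2) ψ(y + b/2)` is the inverse Fourier transform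
of the characteristic function, and comparing its values at different `b` forces all symplectic
eigenvalues of `C` to be `1`; hence the global minimum is `½ (m₁ + m₂)` and `C` is symplectic. For
a symplectic `C` with reduced blocks `A`, `B` and correlations `X`, the matrices `-1 - (J A)²` and
`-1 - (J B)²` are the two products of `J X` and `J Xᵀ`, so they have the same nonzero eigenvalues
among `νᵢ² - 1` and `μⱼ² - 1`. Therefore `∑ (νᵢ - 1) = ∑ (μⱼ - 1)`, and the gap
`½ ∑ (νᵢ - 1) + ½ ∑ (μⱼ - 1)` equals `∑ (νᵢ - 1)`.
-/

noncomputable section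

namespace CV

/-! ### Symplectic matrices -/

section SymplecticGroup

variable {ι R : Type*} [Fintype ι] [DecidableEq ι] [CommRing R]

theorem dotProduct_J_mulVec (v w : ι ⊕ ι → R) :
    v ⬝ᵥ (J ι R *ᵥ w) = (fun i => v (Sum.inr i)) ⬝ᵥ (fun i => w (Sum.inl i)) -
      (fun i => v (Sum.inl i)) ⬝ᵥ fun i => w (Sum.inr i) := by
  simp [J, fromBlocks_mulVec, dotProduct, Function.comp_def, Matrix.neg_mulVec]
  ring

theorem dotProduct_J_mulVec_self (v : ι ⊕ ι → R) : v ⬝ᵥ (J ι R *ᵥ v) = 0 := by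
  rw [dotProduct_J_mulVec, dotProduct_comm, sub_self]

theorem isUnit_of_mem_symplecticGroup {S : Matrix (ι ⊕ ι) (ι ⊕ ι) R}
    (hS : S ∈ symplecticGroup ι R) : IsUnit S :=
  (Matrix.isUnit_iff_isUnit_det S).2 (SymplecticGroup.symplectic_det hS)

theorem inv_mem_symplecticGroup {S : Matrix (ι ⊕ ι) (ι ⊕ ι) R} (hS : S ∈ symplecticGroup ι R) :
    S⁻¹ ∈ symplecticGroup ι R :=
  SymplecticGroup.coe_inv' ⟨S, hS⟩ ▸ (⟨S, hS⟩⁻¹ : symplecticGroup ι R).2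

theorem transvection_mem_symplecticGroup (v : ι ⊕ ι → R) (t : R) :
    1 + t • (vecMulVec v v * J ι R) ∈ symplecticGroup ι R := by
  have hv : vecMulVec v v * J ι R * vecMulVec v v = 0 := by
    rw [Matrix.mul_assoc, mul_vecMulVec, vecMulVec_mul_vecMulVec, dotProduct_J_mulVec_self,
      zero_smul, vecMulVec_zero]
  have hJ (M : Matrix (ι ⊕ ι) (ι ⊕ ι) R) : J ι R * (J ι R * M) = -M := by
    rw [← Matrix.mul_assoc, J_squared, Matrix.neg_mul, Matrix.one_mul]
  rw [Matrix.mul_assoc] at hv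
  rw [SymplecticGroup.mem_iff]
  simp [Matrix.add_mul, Matrix.mul_add, Matrix.mul_assoc, J_transpose, J_squared,
    transpose_vecMulVec, hJ, hv]

theorem isClosed_symplecticGroup [TopologicalSpace R] [IsTopologicalRing R] [T2Space R] :
    IsClosed (symplecticGroup ι R : Set (Matrix (ι ⊕ ι) (ι ⊕ ι) R)) := by
  have : (symplecticGroup ι R : Set (Matrix (ι ⊕ ι) (ι ⊕ ι) R)) = {A | A * J ι R * Aᵀ = J ι R} :=
    Set.ext fun _ => SymplecticGroup.mem_iff
  rw [this]
  exact isClosed_eq (by fun_prop) continuous_const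

end SymplecticGroup

section Realify

variable {ι : Type*}

/-- The real `2m × 2m` matrix of a complex `m × m` matrix acting on `ℂᵐ = ℝᵐ ⊕ i ℝᵐ`; unitary
matrices become orthogonal symplectic ones. -/
def realify (Z : Matrix ι ι ℂ) : Matrix (ι ⊕ ι) (ι ⊕ ι) ℝ :=
  fromBlocks (Z.map Complex.re) (-Z.map Complex.im) (Z.map Complex.im) (Z.map Complex.re)

theorem realify_injective : Function.Injective (realify (ι := ι)) := by
  intro Z W h
  obtain ⟨hre, -, him, -⟩ := fromBlocks_inj.1 h
  ext i j
  exact Complex.ext (congrFun₂ hre i j) (congrFun₂ him i j)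

theorem realify_conjTranspose (Z : Matrix ι ι ℂ) : realify Zᴴ = (realify Z)ᵀ := by
  ext (i | i) (j | j) <;> simp [realify]

theorem realify_mul [Fintype ι] (Z W : Matrix ι ι ℂ) : realify (Z * W) = realify Z * realify W := by
  rw [realify, realify, realify, fromBlocks_multiply]
  congr 1 <;> ext i j <;>
    simp [Matrix.mul_apply, Finset.sum_add_distrib, sub_eq_add_neg, add_comm]

theorem realify_I [DecidableEq ι] : realify (Complex.I • (1 : Matrix ι ι ℂ)) = J ι ℝ := by
  ext (i | i) (j | j) <;> by_cases h : i = j <;> simp [realify, J, h]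

theorem realify_diagonal [DecidableEq ι] (d : ι → ℝ) :
    realify (diagonal fun i => (d i : ℂ)) = diagonal (Sum.elim d d) := by
  ext (i | i) (j | j) <;> by_cases h : i = j <;> simp [realify, h]

variable [Fintype ι] [DecidableEq ι]

theorem realify_mem_symplecticGroup {V : Matrix ι ι ℂ} (hV : V * Vᴴ = 1) :
    realify V ∈ symplecticGroup ι ℝ := by
  rw [SymplecticGroup.mem_iff, ← realify_conjTranspose, ← realify_I, ← realify_mul, ← realify_mul]
  simp only [Matrix.mul_smul, Matrix.mul_one, Matrix.smul_mul, hV]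

theorem exists_realify_eq_of_commute_J {D : Matrix (ι ⊕ ι) (ι ⊕ ι) ℝ} (h : Commute (J ι ℝ) D) :
    ∃ Z, realify Z = D := by
  obtain ⟨P, Q, R, T, rfl⟩ : ∃ P Q R T, D = fromBlocks P Q R T :=
    ⟨_, _, _, _, (fromBlocks_toBlocks D).symm⟩
  have h := h.eq
  simp only [J, fromBlocks_multiply, Matrix.zero_mul, Matrix.mul_zero, Matrix.neg_mul,
    Matrix.mul_neg, Matrix.one_mul, Matrix.mul_one, zero_add, add_zero, fromBlocks_inj] at h
  obtain ⟨rfl, -, rfl, -⟩ := h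
  exact ⟨Matrix.of fun i j => ⟨P i j, R i j⟩, by ext (i | i) (j | j) <;> simp [realify]⟩

end Realify

/-! ### Williamson's normal form -/

section Williamson

theorem exists_eq_mul_transpose_of_posDef {n : Type*} [Fintype n] [DecidableEq n]
    {C : Matrix n n ℝ} (hC : C.PosDef) : ∃ B : Matrix n n ℝ, IsUnit B ∧ C = B * Bᵀ := by
  open scoped MatrixOrder in
  obtain ⟨B, hB, h⟩ := (CStarAlgebra.isStrictlyPositive_iff_eq_star_mul_self).1
    hC.isStrictlyPositive
  exact ⟨Bᵀ, by simpa using hB, by simpa [star_eq_conjTranspose] using h⟩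

theorem posDef_mul_mul_transpose {n : Type*} [Fintype n] [DecidableEq n] {C S : Matrix n n ℝ}
    (hC : C.PosDef) (hS : IsUnit S) : (S * C * Sᵀ).PosDef := by
  simpa [star_eq_conjTranspose] using (IsUnit.posDef_star_right_conjugate_iff hS).2 hC

open scoped Matrix.Norms.Elementwise in
theorem tendsto_trace_mul_transpose_self_cocompact (m n : Type*) [Fintype m] [Fintype n] :
    Filter.Tendsto (fun T : Matrix m n ℝ => (T * Tᵀ).trace) (Filter.cocompact _) Filter.atTop := by
  have htrace (T : Matrix m n ℝ) : (T * Tᵀ).trace = ∑ i, ∑ j, T i j ^ 2 := by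
    simp [Matrix.trace, Matrix.mul_apply, sq]
  have hnorm (T : Matrix m n ℝ) : ‖T‖ ^ 2 ≤ (T * Tᵀ).trace := by
    have h0 : 0 ≤ (T * Tᵀ).trace := by rw [htrace]; positivity
    refine (Real.le_sqrt (norm_nonneg T) h0).1 <|
      (Matrix.norm_le_iff (Real.sqrt_nonneg _)).2 fun i j => Real.le_sqrt_of_sq_le ?_
    rw [Real.norm_eq_abs, sq_abs, htrace]
    calc T i j ^ 2 ≤ ∑ j, T i j ^ 2 :=
          Finset.single_le_sum (f := fun j => T i j ^ 2) (fun _ _ => sq_nonneg _)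
            (Finset.mem_univ j)
      _ ≤ ∑ i, ∑ j, T i j ^ 2 :=
          Finset.single_le_sum (f := fun i => ∑ j, T i j ^ 2)
            (fun _ _ => Finset.sum_nonneg fun _ _ => sq_nonneg _) (Finset.mem_univ i)
  exact Filter.tendsto_atTop_mono hnorm <|
    (Filter.tendsto_pow_atTop two_ne_zero).comp tendsto_norm_cocompact_atTop

theorem exists_isMinOn_trace_mul_mul_transpose {m n : Type*} [Fintype m] [Fintype n]
    {C : Matrix n n ℝ} (hC : C.PosDef) {s : Set (Matrix m n ℝ)} (hs : IsClosed s)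
    (hne : s.Nonempty) : ∃ S ∈ s, IsMinOn (fun S => (S * C * Sᵀ).trace) s S := by
  classical
  obtain ⟨S₀, hS₀⟩ := hne
  obtain ⟨B, hB, rfl⟩ := exists_eq_mul_transpose_of_posDef hC
  have hdet := (Matrix.isUnit_iff_isUnit_det B).1 hB
  have hclosed : Topology.IsClosedEmbedding fun S : Matrix m n ℝ => S * B :=
    Function.LeftInverse.isClosedEmbedding (f := fun S => S * B⁻¹)
      (fun S => mul_nonsing_inv_cancel_right B S hdet) (by fun_prop) (by fun_prop)
  have htendsto : Filter.Tendsto (fun S : Matrix m n ℝ => (S * (B * Bᵀ) * Sᵀ).trace)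
      (Filter.cocompact _) Filter.atTop := by
    simpa [Function.comp_def, Matrix.mul_assoc] using
      (tendsto_trace_mul_transpose_self_cocompact m n).comp hclosed.tendsto_cocompact
  exact ContinuousOn.exists_isMinOn' (by fun_prop) hs hS₀
    ((htendsto.eventually_ge_atTop _).filter_mono inf_le_left)

theorem transpose_eq_neg_of_dotProduct_mulVec_self {n R : Type*} [Fintype n] [CommRing R]
    {M : Matrix n n R} (h : ∀ v, v ⬝ᵥ (M *ᵥ v) = 0) : Mᵀ = -M := by
  classical
  ext i j
  have hij := h (Pi.single i 1 + Pi.single j 1)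
  simp only [mulVec_add, dotProduct_add, add_dotProduct, h, zero_add, add_zero] at hij
  simpa [eq_neg_iff_add_eq_zero, add_comm] using hij

theorem trace_one_add_smul_mul_mul_transpose {n R : Type*} [Fintype n] [DecidableEq n] [CommRing R]
    {C : Matrix n n R} (hC : C.IsSymm) (X : Matrix n n R) (t : R) :
    ((1 + t • X) * C * (1 + t • X)ᵀ).trace =
      (X * C * Xᵀ).trace * (t * t) + 2 * (X * C).trace * t + C.trace := by
  have h : (C * Xᵀ).trace = (X * C).trace := by
    rw [← Matrix.trace_transpose, transpose_mul, transpose_transpose, hC.eq]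
  simp only [transpose_add, transpose_one, transpose_smul, Matrix.add_mul, Matrix.mul_add,
    Matrix.one_mul, Matrix.mul_one, Matrix.smul_mul, Matrix.mul_smul, trace_add, trace_smul,
    h, smul_eq_mul]
  ring

variable {ι : Type*} [Fintype ι] [DecidableEq ι]

theorem commute_J_of_forall_trace_le {C : Matrix (ι ⊕ ι) (ι ⊕ ι) ℝ} (hC : C.IsSymm)
    (h : ∀ T ∈ symplecticGroup ι ℝ, C.trace ≤ (T * C * Tᵀ).trace) : Commute (J ι ℝ) C := by
  have hquad (v : ι ⊕ ι → ℝ) : v ⬝ᵥ ((J ι ℝ * C) *ᵥ v) = 0 := by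
    set X := vecMulVec v v * J ι ℝ with hX
    have hXC : (X * C).trace = v ⬝ᵥ ((J ι ℝ * C) *ᵥ v) := by
      rw [hX, Matrix.mul_assoc, Matrix.trace_mul_comm, Matrix.mul_vecMulVec, trace_vecMulVec,
        dotProduct_comm]
    -- The transvections form a one-parameter group, along which the trace is stationary.
    have hdiscrim : discrim (X * C * Xᵀ).trace (2 * (X * C).trace) 0 ≤ 0 :=
      discrim_le_zero fun t => by
        have := h _ (transvection_mem_symplecticGroup v t)
        rw [trace_one_add_smul_mul_mul_transpose hC] at this
        linarith
    rw [← hXC]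
    simpa [discrim, sq_nonpos_iff] using hdiscrim
  have := transpose_eq_neg_of_dotProduct_mulVec_self hquad
  rw [transpose_mul, J_transpose, hC.eq, Matrix.mul_neg, neg_inj] at this
  exact this.symm

theorem exists_mul_mul_transpose_eq_diagonal {D : Matrix (ι ⊕ ι) (ι ⊕ ι) ℝ} (hD : D.IsSymm)
    (hJ : Commute (J ι ℝ) D) :
    ∃ S ∈ symplecticGroup ι ℝ, ∃ d : ι → ℝ, S * D * Sᵀ = diagonal (Sum.elim d d) := by
  obtain ⟨Z, rfl⟩ := exists_realify_eq_of_commute_J hJ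
  have hZ : Z.IsHermitian := realify_injective (by rw [realify_conjTranspose, hD.eq])
  set V : Matrix ι ι ℂ := ↑hZ.eigenvectorUnitary
  have hV : Vᴴ * Vᴴᴴ = 1 := by
    rw [conjTranspose_conjTranspose]
    exact Unitary.coe_star_mul_self hZ.eigenvectorUnitary
  have hVZ : Vᴴ * Z * Vᴴᴴ = diagonal fun i => (hZ.eigenvalues i : ℂ) :=
    hZ.conjStarAlgAut_star_eigenvectorUnitary
  refine ⟨realify Vᴴ, realify_mem_symplecticGroup hV, hZ.eigenvalues, ?_⟩
  rw [← realify_conjTranspose, ← realify_mul, ← realify_mul, hVZ, realify_diagonal]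

/-- **Williamson's theorem.** -/
theorem exists_isSymplecticSpectrum {C : Matrix (ι ⊕ ι) (ι ⊕ ι) ℝ} (hC : C.PosDef) :
    ∃ ν : ι → ℝ, IsSymplecticSpectrum C ν := by
  obtain ⟨S, hS, hmin⟩ := exists_isMinOn_trace_mul_mul_transpose hC
    isClosed_symplecticGroup ⟨1, one_mem (symplecticGroup ι ℝ)⟩
  have hpos : (S * C * Sᵀ).PosDef := posDef_mul_mul_transpose hC (isUnit_of_mem_symplecticGroup hS)
  have hsymm : (S * C * Sᵀ).IsSymm := by simpa using hpos.isHermitian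
  have hJ : Commute (J ι ℝ) (S * C * Sᵀ) := commute_J_of_forall_trace_le hsymm fun T hT => by
    simpa [Matrix.mul_assoc] using hmin (mul_mem hT hS)
  obtain ⟨O, hO, ν, hν⟩ := exists_mul_mul_transpose_eq_diagonal hsymm hJ
  refine ⟨ν, fun i => ?_, O * S, mul_mem hO hS, by simpa [Matrix.mul_assoc] using hν⟩
  have := (posDef_mul_mul_transpose hpos (isUnit_of_mem_symplecticGroup hO)).diag_pos
    (i := Sum.inl i)
  simpa [hν] using this

end Williamson

section TraceBound

variable {ι : Type*} [Fintype ι] [DecidableEq ι]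

theorem two_le_transpose_mul_self_diag {S : Matrix (ι ⊕ ι) (ι ⊕ ι) ℝ}
    (hS : S ∈ symplecticGroup ι ℝ) (i : ι) :
    2 ≤ (Sᵀ * S) (Sum.inl i) (Sum.inl i) + (Sᵀ * S) (Sum.inr i) (Sum.inr i) := by
  set u := S.col (Sum.inl i)
  set v := S.col (Sum.inr i)
  have huv : u ⬝ᵥ (J ι ℝ *ᵥ v) = -1 := by
    have h := congrFun₂ (SymplecticGroup.mem_iff'.1 hS) (Sum.inl i) (Sum.inr i)
    rw [Matrix.mul_assoc] at h
    exact h.trans (by simp [J])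
  have hJv : (J ι ℝ *ᵥ v) ⬝ᵥ (J ι ℝ *ᵥ v) = v ⬝ᵥ v := by
    rw [dotProduct_mulVec, ← mulVec_transpose, J_transpose, mulVec_mulVec, Matrix.neg_mul,
      J_squared, neg_neg, one_mulVec]
  have hnonneg : 0 ≤ (u + J ι ℝ *ᵥ v) ⬝ᵥ (u + J ι ℝ *ᵥ v) :=
    Finset.sum_nonneg fun _ _ => mul_self_nonneg _
  rw [add_dotProduct, dotProduct_add, dotProduct_add, dotProduct_comm (J ι ℝ *ᵥ v) u, huv, hJv]
    at hnonneg
  change 2 ≤ u ⬝ᵥ u + v ⬝ᵥ v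
  linarith

theorem two_mul_sum_le_trace_mul_mul_transpose {C : Matrix (ι ⊕ ι) (ι ⊕ ι) ℝ} {ν : ι → ℝ}
    (h : IsSymplecticSpectrum C ν) {T : Matrix (ι ⊕ ι) (ι ⊕ ι) ℝ} (hT : T ∈ symplecticGroup ι ℝ) :
    2 * ∑ i, ν i ≤ (T * C * Tᵀ).trace := by
  obtain ⟨hν, S, hS, hSC⟩ := h
  obtain ⟨R, hR, rfl⟩ : ∃ R ∈ symplecticGroup ι ℝ, T = R * S :=
    ⟨T * S⁻¹, mul_mem hT (inv_mem_symplecticGroup hS),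
      (nonsing_inv_mul_cancel_right S T (SymplecticGroup.symplectic_det hS)).symm⟩
  calc 2 * ∑ i, ν i
      ≤ ∑ i, ((Rᵀ * R) (Sum.inl i) (Sum.inl i) + (Rᵀ * R) (Sum.inr i) (Sum.inr i)) * ν i := by
        rw [Finset.mul_sum]
        exact Finset.sum_le_sum fun i _ =>
          mul_le_mul_of_nonneg_right (two_le_transpose_mul_self_diag hR i) (hν i).le
    _ = (Rᵀ * R * diagonal (Sum.elim ν ν)).trace := by
        simp [Matrix.trace, mul_diagonal, Fintype.sum_sum_type, ← Finset.sum_add_distrib, add_mul]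
    _ = (R * diagonal (Sum.elim ν ν) * Rᵀ).trace := by
        rw [Matrix.mul_assoc, Matrix.trace_mul_comm]
    _ = (R * S * C * (R * S)ᵀ).trace := by
        rw [← hSC, transpose_mul]
        simp only [Matrix.mul_assoc]

end TraceBound

/-! ### The symplectic spectra of complementary blocks -/

section ReducedSpectra

open Polynomial

theorem charpoly_eq_of_semiconjBy {n R : Type*} [Fintype n] [DecidableEq n] [CommRing R]
    {P M N : Matrix n n R} (hP : IsUnit P) (h : SemiconjBy P M N) : M.charpoly = N.charpoly := by
  obtain ⟨u, rfl⟩ := hP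
  rw [← charpoly_units_conj u M, h.eq, ← coe_units_inv, Units.mul_inv_cancel_right]

theorem sum_sqrt_roots {ι : Type*} [Fintype ι] (n : ℕ) {ν : ι → ℝ} (hν : ∀ i, 0 ≤ ν i) :
    (((X ^ n * (∏ i, (X - C (ν i ^ 2 - 1))) ^ 2 : ℝ[X]).roots.map
      fun r => √(r + 1) - 1).sum) = 2 * ∑ i, (ν i - 1) := by
  have hp : (∏ i, (X - C (ν i ^ 2 - 1)) : ℝ[X]) ≠ 0 :=
    Finset.prod_ne_zero_iff.2 fun i _ => X_sub_C_ne_zero _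
  rw [roots_mul (mul_ne_zero (pow_ne_zero _ X_ne_zero) (pow_ne_zero _ hp)), roots_pow, roots_pow,
    roots_X, roots_prod _ _ hp]
  simp only [roots_X_sub_C, Multiset.bind_singleton, Multiset.map_add, Multiset.sum_add,
    Multiset.map_nsmul, Multiset.sum_nsmul, Multiset.map_singleton, Multiset.sum_singleton,
    Multiset.map_map, Function.comp_def, sub_add_cancel, zero_add, Real.sqrt_one, sub_self,
    smul_zero, Real.sqrt_sq (hν _), nsmul_eq_mul, Nat.cast_ofNat]
  rfl

variable {ι κ : Type*}

/-- The block of a covariance matrix on the quadratures of the second subsystem, complementary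
to `reducedCov`. -/
def reducedCovRight (C : Matrix ((ι ⊕ κ) ⊕ (ι ⊕ κ)) ((ι ⊕ κ) ⊕ (ι ⊕ κ)) ℝ) :
    Matrix (κ ⊕ κ) (κ ⊕ κ) ℝ :=
  C.submatrix (Sum.map Sum.inr Sum.inr) (Sum.map Sum.inr Sum.inr)

/-- The correlations between the two subsystems: the off-diagonal block of a covariance matrix
of the joint system. -/
def correlationBlock (C : Matrix ((ι ⊕ κ) ⊕ (ι ⊕ κ)) ((ι ⊕ κ) ⊕ (ι ⊕ κ)) ℝ) :
    Matrix (ι ⊕ ι) (κ ⊕ κ) ℝ :=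
  C.submatrix (Sum.map Sum.inl Sum.inl) (Sum.map Sum.inr Sum.inr)

theorem submatrix_sumSumSumComm_eq_fromBlocks
    {M : Matrix ((ι ⊕ κ) ⊕ (ι ⊕ κ)) ((ι ⊕ κ) ⊕ (ι ⊕ κ)) ℝ} (hM : M.IsSymm) :
    M.submatrix (Equiv.sumSumSumComm ι ι κ κ) (Equiv.sumSumSumComm ι ι κ κ) =
      fromBlocks (reducedCov M) (correlationBlock M) (correlationBlock M)ᵀ (reducedCovRight M) := by
  ext ((i | i) | (i | i)) ((j | j) | (j | j)) <;> first | rfl | exact hM.apply _ _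

theorem posDef_reducedCov {C : Matrix ((ι ⊕ κ) ⊕ (ι ⊕ κ)) ((ι ⊕ κ) ⊕ (ι ⊕ κ)) ℝ}
    (hC : C.PosDef) : (reducedCov C).PosDef :=
  hC.submatrix (Sum.map_injective.2 ⟨Sum.inl_injective, Sum.inl_injective⟩)

theorem posDef_reducedCovRight {C : Matrix ((ι ⊕ κ) ⊕ (ι ⊕ κ)) ((ι ⊕ κ) ⊕ (ι ⊕ κ)) ℝ}
    (hC : C.PosDef) : (reducedCovRight C).PosDef :=
  hC.submatrix (Sum.map_injective.2 ⟨Sum.inr_injective, Sum.inr_injective⟩)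

variable [DecidableEq ι] [DecidableEq κ]

theorem J_submatrix_sumSumSumComm :
    (J (ι ⊕ κ) ℝ).submatrix (Equiv.sumSumSumComm ι ι κ κ) (Equiv.sumSumSumComm ι ι κ κ) =
      fromBlocks (J ι ℝ) 0 0 (J κ ℝ) := by
  ext ((i | i) | (i | i)) ((j | j) | (j | j)) <;> simp [J, Matrix.one_apply]

variable [Fintype ι] [Fintype κ]

theorem charpoly_of_isSymplecticSpectrum {A : Matrix (ι ⊕ ι) (ι ⊕ ι) ℝ} {ν : ι → ℝ}
    (h : IsSymplecticSpectrum A ν) :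
    (-1 - J ι ℝ * A * (J ι ℝ * A)).charpoly = (∏ i, (X - C (ν i ^ 2 - 1))) ^ 2 := by
  obtain ⟨-, S, hS, hSA⟩ := h
  set D := diagonal (Sum.elim ν ν) with hD
  have hsemiconj : SemiconjBy Sᵀ (J ι ℝ * D) (J ι ℝ * A) := by
    rw [SemiconjBy, ← hSA, ← Matrix.mul_assoc, ← Matrix.mul_assoc, ← Matrix.mul_assoc,
      SymplecticGroup.mem_iff'.1 hS]
  have hdiag : -1 - J ι ℝ * D * (J ι ℝ * D) =
      diagonal (Sum.elim (fun i => ν i ^ 2 - 1) fun i => ν i ^ 2 - 1) := by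
    ext (i | i) (j | j) <;> by_cases hij : i = j <;>
      simp [hD, ← fromBlocks_diagonal, J, fromBlocks_multiply, hij, sq] <;> ring
  rw [← charpoly_eq_of_semiconjBy
    (isUnit_of_mem_symplecticGroup (SymplecticGroup.transpose_mem hS))
    ((SemiconjBy.one_right _).neg_right.sub_right (hsemiconj.mul_right hsemiconj)), hdiag,
    charpoly_diagonal, Fintype.prod_sum_type]
  simp [sq]

theorem mul_J_mul_add_of_mem_symplecticGroup
    {M : Matrix ((ι ⊕ κ) ⊕ (ι ⊕ κ)) ((ι ⊕ κ) ⊕ (ι ⊕ κ)) ℝ} (hsymm : M.IsSymm)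
    (hM : M ∈ symplecticGroup (ι ⊕ κ) ℝ) :
    reducedCov M * J ι ℝ * reducedCov M +
        correlationBlock M * J κ ℝ * (correlationBlock M)ᵀ = J ι ℝ ∧
      (correlationBlock M)ᵀ * J ι ℝ * correlationBlock M +
        reducedCovRight M * J κ ℝ * reducedCovRight M = J κ ℝ := by
  have h := congrArg (fun N => N.submatrix (Equiv.sumSumSumComm ι ι κ κ)
    (Equiv.sumSumSumComm ι ι κ κ)) (SymplecticGroup.mem_iff.1 hM)
  simp only [hsymm.eq, ← submatrix_mul_equiv _ _ _ (Equiv.sumSumSumComm ι ι κ κ) _,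
    submatrix_sumSumSumComm_eq_fromBlocks hsymm, J_submatrix_sumSumSumComm, fromBlocks_multiply,
    fromBlocks_inj, Matrix.mul_zero, add_zero, zero_add] at h
  exact ⟨h.1, h.2.2.2⟩

theorem sum_sub_one_eq_of_mem_symplecticGroup
    {M : Matrix ((ι ⊕ κ) ⊕ (ι ⊕ κ)) ((ι ⊕ κ) ⊕ (ι ⊕ κ)) ℝ} (hsymm : M.IsSymm)
    (hM : M ∈ symplecticGroup (ι ⊕ κ) ℝ) {ν : ι → ℝ} {μ : κ → ℝ}
    (hν : IsSymplecticSpectrum (reducedCov M) ν)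
    (hμ : IsSymplecticSpectrum (reducedCovRight M) μ) :
    ∑ i, (ν i - 1) = ∑ j, (μ j - 1) := by
  set A := reducedCov M
  set B := reducedCovRight M
  set Γ := correlationBlock M
  obtain ⟨hA, hB⟩ := mul_J_mul_add_of_mem_symplecticGroup hsymm hM
  have hΓA : J ι ℝ * Γ * (J κ ℝ * Γᵀ) = -1 - J ι ℝ * A * (J ι ℝ * A) := by
    rw [eq_sub_iff_add_eq', ← J_squared ι ℝ]
    simpa only [Matrix.mul_add, Matrix.mul_assoc] using congrArg (J ι ℝ * ·) hA
  have hΓB : J κ ℝ * Γᵀ * (J ι ℝ * Γ) = -1 - J κ ℝ * B * (J κ ℝ * B) := by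
    rw [eq_sub_iff_add_eq, ← J_squared κ ℝ]
    simpa only [Matrix.mul_add, Matrix.mul_assoc] using congrArg (J κ ℝ * ·) hB
  have hchar := charpoly_mul_comm' (J ι ℝ * Γ) (J κ ℝ * Γᵀ)
  rw [hΓA, hΓB, charpoly_of_isSymplecticSpectrum hν, charpoly_of_isSymplecticSpectrum hμ] at hchar
  have hroots := congrArg (fun p : ℝ[X] => (p.roots.map fun r => √(r + 1) - 1).sum) hchar
  simp only [sum_sqrt_roots _ fun i => (hν.1 i).le, sum_sqrt_roots _ fun j => (hμ.1 j).le] at hroots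
  linarith

end ReducedSpectra

/-! ### Total families, Fourier uniqueness and Weyl operators -/

section Gram

variable {𝕜 E F α : Type*} [RCLike 𝕜] [NormedAddCommGroup E] [InnerProductSpace 𝕜 E]
  [NormedAddCommGroup F] [InnerProductSpace 𝕜 F]

theorem denseRange_linearCombination {v : α → E}
    (hv : Dense (Submodule.span 𝕜 (Set.range v) : Set E)) :
    DenseRange (Finsupp.linearCombination 𝕜 v) := by
  rwa [DenseRange, ← LinearMap.coe_range, Finsupp.range_linearCombination]

theorem norm_linearCombination_eq_of_inner_eq {v : α → E} {w : α → F}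
    (h : ∀ i j, inner 𝕜 (v i) (v j) = inner 𝕜 (w i) (w j)) (x : α →₀ 𝕜) :
    ‖Finsupp.linearCombination 𝕜 w x‖ = ‖Finsupp.linearCombination 𝕜 v x‖ := by
  have hinner : inner 𝕜 (Finsupp.linearCombination 𝕜 w x) (Finsupp.linearCombination 𝕜 w x) =
      inner 𝕜 (Finsupp.linearCombination 𝕜 v x) (Finsupp.linearCombination 𝕜 v x) := by
    simp only [Finsupp.linearCombination_apply, Finsupp.sum, sum_inner, inner_sum,
      inner_smul_left, inner_smul_right, h]
  rw [norm_eq_sqrt_re_inner (𝕜 := 𝕜), norm_eq_sqrt_re_inner (𝕜 := 𝕜), hinner]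

theorem exists_linearIsometryEquiv_of_inner_eq [CompleteSpace E] [CompleteSpace F] {v : α → E}
    {w : α → F} (hv : Dense (Submodule.span 𝕜 (Set.range v) : Set E))
    (hw : Dense (Submodule.span 𝕜 (Set.range w) : Set F))
    (h : ∀ i j, inner 𝕜 (v i) (v j) = inner 𝕜 (w i) (w j)) :
    ∃ U : E ≃ₗᵢ[𝕜] F, ∀ i, U (v i) = w i := by
  have hnorm := norm_linearCombination_eq_of_inner_eq h
  have hv' := denseRange_linearCombination hv
  have hw' := denseRange_linearCombination hw
  refine ⟨(LinearEquiv.refl 𝕜 (α →₀ 𝕜)).extendOfIsometry (Finsupp.linearCombination 𝕜 v)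
    (Finsupp.linearCombination 𝕜 w) hv' hw' hnorm, fun i => ?_⟩
  simpa using LinearEquiv.extendOfIsometry_eq (LinearEquiv.refl 𝕜 (α →₀ 𝕜)) _ _ hv' hw' hnorm
    (Finsupp.single i 1)

end Gram

section Fourier

open scoped FourierTransform SchwartzMap ContDiff

theorem ae_eq_zero_of_fourier_eq_zero {V E : Type*} [NormedAddCommGroup V] [InnerProductSpace ℝ V]
    [FiniteDimensional ℝ V] [MeasurableSpace V] [BorelSpace V] [NormedAddCommGroup E]
    [NormedSpace ℂ E] [CompleteSpace E] {f : V → E} (hf : Integrable f) (h : 𝓕 f = 0) :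
    f =ᵐ[volume] 0 := by
  refine ae_eq_zero_of_integral_contDiff_smul_eq_zero hf.locallyIntegrable fun g hg hsupp => ?_
  let G : 𝓢(V, ℂ) := (hsupp.comp_left (g := Complex.ofReal) rfl).toSchwartzMap
    (Complex.ofRealCLM.contDiff.comp hg)
  obtain ⟨H, hH⟩ : ∃ H : 𝓢(V, ℂ), 𝓕 H = G := ⟨𝓕⁻ G, FourierTransform.fourier_fourierInv_eq G⟩
  have hG (x : V) : G x = (g x : ℂ) := rfl
  calc ∫ x, g x • f x = ∫ x, 𝓕 (H : V → ℂ) x • f x := by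
        simp only [← SchwartzMap.fourier_coe, hH, hG, Complex.coe_smul]
    _ = ∫ x, H x • 𝓕 f x := by
        simpa only [flip_innerₗ] using! VectorFourier.integral_fourierIntegral_smul_eq_flip
          (L := innerₗ V) Real.continuous_fourierChar continuous_inner H.integrable hf
    _ = 0 := by simp [h]

theorem ae_eq_zero_of_integral_exp_dotProduct_mul_eq_zero {ι : Type*} [Fintype ι]
    {f : (ι → ℝ) → ℂ} (hf : Integrable f)
    (h : ∀ a : ι → ℝ, ∫ x, Complex.exp (Complex.I * ((a ⬝ᵥ x : ℝ) : ℂ)) * f x = 0) :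
    f =ᵐ[volume] 0 := by
  have hpres := PiLp.volume_preserving_ofLp ι
  have hemb : MeasurableEmbedding (@WithLp.ofLp 2 (ι → ℝ)) :=
    (MeasurableEquiv.toLp 2 (ι → ℝ)).symm.measurableEmbedding
  have hF : f ∘ WithLp.ofLp =ᵐ[(volume : Measure (EuclideanSpace ℝ ι))] 0 := by
    refine ae_eq_zero_of_fourier_eq_zero (hpres.integrable_comp_of_integrable hf) ?_
    ext w
    rw [Real.fourier_eq', Pi.zero_apply, ← h (-(2 * Real.pi) • WithLp.ofLp w),
      ← hpres.integral_comp hemb]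
    refine integral_congr_ae (.of_forall fun x => ?_)
    simp [EuclideanSpace.inner_eq_star_dotProduct, mul_comm Complex.I]
  filter_upwards [(PiLp.volume_preserving_toLp ι).quasiMeasurePreserving.ae hF] with x hx using hx

end Fourier

section Weyl

variable {ι : Type*} [Fintype ι]

theorem coeFn_weyl (ξ : Phase ι) (ψ : Hilb ι) : weyl ξ ψ =ᵐ[volume] weylFun ξ ψ :=
  MemLp.coeFn_toLp _

theorem weylFun_congr (ξ : Phase ι) {f g : (ι → ℝ) → ℂ} (h : f =ᵐ[volume] g) :
    weylFun ξ f =ᵐ[volume] weylFun ξ g := by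
  filter_upwards
    [(measurePreserving_add_right volume (momPart ξ)).quasiMeasurePreserving.ae_eq_comp h] with x hx
  exact congrArg (_ * ·) hx

theorem norm_weylFun (ξ : Phase ι) (f : (ι → ℝ) → ℂ) (x : ι → ℝ) :
    ‖weylFun ξ f x‖ = ‖f (x + momPart ξ)‖ := by
  rw [weylFun, norm_mul, Complex.norm_exp_I_mul_ofReal, one_mul]

theorem weyl_add (ξ : Phase ι) (ψ φ : Hilb ι) : weyl ξ (ψ + φ) = weyl ξ ψ + weyl ξ φ := by
  apply Lp.ext
  filter_upwards [coeFn_weyl ξ (ψ + φ), Lp.coeFn_add (weyl ξ ψ) (weyl ξ φ), coeFn_weyl ξ ψ,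
    coeFn_weyl ξ φ, weylFun_congr ξ (Lp.coeFn_add ψ φ)] with x h1 h2 h3 h4 h5
  rw [h1, h2, h5, Pi.add_apply, h3, h4]
  simp only [weylFun, Pi.add_apply, mul_add]

theorem weyl_smul (ξ : Phase ι) (c : ℂ) (ψ : Hilb ι) : weyl ξ (c • ψ) = c • weyl ξ ψ := by
  apply Lp.ext
  filter_upwards [coeFn_weyl ξ (c • ψ), Lp.coeFn_smul c (weyl ξ ψ), coeFn_weyl ξ ψ,
    weylFun_congr ξ (Lp.coeFn_smul c ψ)] with x h1 h2 h3 h4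
  rw [h1, h2, h4, Pi.smul_apply, h3]
  simp only [weylFun, Pi.smul_apply, smul_eq_mul, mul_left_comm]

theorem weyl_zero (ψ : Hilb ι) : weyl 0 ψ = ψ := by
  apply Lp.ext
  filter_upwards [coeFn_weyl 0 ψ] with x hx
  have hpos : posPart (0 : Phase ι) = 0 := rfl
  have hmom : momPart (0 : Phase ι) = 0 := rfl
  simp [hx, weylFun, hpos, hmom]

theorem norm_weyl (ξ : Phase ι) (ψ : Hilb ι) : ‖weyl ξ ψ‖ = ‖ψ‖ := by
  rw [weyl, Lp.norm_toLp, Lp.norm_def, ← eLpNorm_comp_measurePreserving (Lp.aestronglyMeasurable ψ)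
    (measurePreserving_add_right volume (momPart ξ))]
  congr 1
  exact eLpNorm_congr_norm_ae (.of_forall (norm_weylFun ξ ψ))

variable [DecidableEq ι] in
theorem weyl_weyl (ξ η : Phase ι) (ψ : Hilb ι) :
    weyl ξ (weyl η ψ) =
      Complex.exp (Complex.I * ((ξ ⬝ᵥ (J ι ℝ *ᵥ η) / 2 : ℝ) : ℂ)) • weyl (ξ + η) ψ := by
  have hJ : ξ ⬝ᵥ (J ι ℝ *ᵥ η) = momPart ξ ⬝ᵥ posPart η - posPart ξ ⬝ᵥ momPart η :=
    dotProduct_J_mulVec ξ η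
  have hpos : posPart (ξ + η) = posPart ξ + posPart η := rfl
  have hmom : momPart (ξ + η) = momPart ξ + momPart η := rfl
  apply Lp.ext
  filter_upwards [coeFn_weyl ξ (weyl η ψ), Lp.coeFn_smul
    (Complex.exp (Complex.I * ((ξ ⬝ᵥ (J ι ℝ *ᵥ η) / 2 : ℝ) : ℂ))) (weyl (ξ + η) ψ),
    coeFn_weyl (ξ + η) ψ, weylFun_congr ξ (coeFn_weyl η ψ)] with x h1 h2 h3 h4
  rw [h1, h2, h4, Pi.smul_apply, h3, smul_eq_mul]
  simp only [weylFun, hpos, hmom, ← mul_assoc, ← Complex.exp_add, ← mul_add, ← Complex.ofReal_add,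
    add_assoc]
  congr 4
  simp only [hJ, add_dotProduct, dotProduct_add, dotProduct_comm (momPart ξ) (posPart η)]
  ring

theorem weyl_neg_weyl (ξ : Phase ι) (ψ : Hilb ι) : weyl (-ξ) (weyl ξ ψ) = ψ := by
  classical
  rw [weyl_weyl, neg_add_cancel, weyl_zero, neg_dotProduct, dotProduct_J_mulVec_self]
  simp

/-- The Weyl operator `W(ξ)` as a unitary. -/
def weylEquiv (ξ : Phase ι) : Hilb ι ≃ₗᵢ[ℂ] Hilb ι where
  toFun := weyl ξ
  map_add' := weyl_add ξ
  map_smul' := weyl_smul ξ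
  invFun := weyl (-ξ)
  left_inv := weyl_neg_weyl ξ
  right_inv ψ := by simpa only [neg_neg] using weyl_neg_weyl (-ξ) ψ
  norm_map' := norm_weyl ξ

theorem inner_weyl_left (ξ : Phase ι) (ψ φ : Hilb ι) :
    inner ℂ (weyl ξ ψ) φ = inner ℂ ψ (weyl (-ξ) φ) :=
  LinearIsometryEquiv.inner_map_eq_flip (weylEquiv ξ) ψ φ

variable [DecidableEq ι] in
theorem inner_weyl_weyl (ξ η : Phase ι) (ψ φ : Hilb ι) :
    inner ℂ (weyl ξ ψ) (weyl η φ) =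
      Complex.exp (-(Complex.I * ((ξ ⬝ᵥ (J ι ℝ *ᵥ η) / 2 : ℝ) : ℂ))) *
        inner ℂ ψ (weyl (η - ξ) φ) := by
  rw [inner_weyl_left, weyl_weyl, inner_smul_right, neg_add_eq_sub, neg_dotProduct, neg_div,
    Complex.ofReal_neg, mul_neg]

end Weyl

/-! ### Moments of Gaussian states -/

section Limits

open Filter Topology

theorem exists_tendsto_of_tendsto_inner {𝕜 E α : Type*} [RCLike 𝕜] [NormedAddCommGroup E]
    [InnerProductSpace 𝕜 E] [CompleteSpace E] {l : Filter α} [l.NeBot] {f : α → E} {K : 𝕜}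
    (hK : Tendsto (fun p : α × α => inner 𝕜 (f p.1) (f p.2)) (l ×ˢ l) (𝓝 K)) :
    ∃ φ, Tendsto f l (𝓝 φ) := by
  refine cauchy_map_iff_exists_tendsto.1 (cauchy_map_iff.2 ⟨inferInstance, ?_⟩)
  rw [tendsto_uniformity_iff_dist_tendsto_zero]
  have hre := (RCLike.continuous_re.tendsto K).comp hK
  have hdiag : Tendsto (fun x => ‖f x‖ ^ 2) l (𝓝 (RCLike.re K)) := by
    simpa only [Function.comp_def, id, ← norm_sq_eq_re_inner] using
      hre.comp (tendsto_id.prodMk tendsto_id)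
  have hsq : Tendsto (fun p : α × α => dist (f p.1) (f p.2) ^ 2) (l ×ˢ l) (𝓝 0) := by
    have := ((hdiag.comp tendsto_fst).sub (hre.const_mul 2)).add (hdiag.comp tendsto_snd)
    simpa only [dist_eq_norm, norm_sub_sq (𝕜 := 𝕜), Function.comp_def, two_mul,
      sub_add_cancel_left, neg_add_cancel] using this
  simpa only [Real.sqrt_sq dist_nonneg, Real.sqrt_zero] using hsq.sqrt

theorem tendsto_mul_nhdsNE_zero :
    Tendsto (fun p : ℝ × ℝ => p.1 * p.2) (𝓝[≠] 0 ×ˢ 𝓝[≠] 0) (𝓝[≠] 0) := by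
  refine tendsto_nhdsWithin_iff.2 ⟨?_, ?_⟩
  · have hmul : Tendsto (fun p : ℝ × ℝ => p.1 * p.2) (𝓝 0 ×ˢ 𝓝 0) (𝓝 0) := by
      simpa only [nhds_prod_eq, mul_zero] using (continuous_mul (M := ℝ)).tendsto (0, 0)
    exact hmul.mono_left (Filter.prod_mono nhdsWithin_le_nhds nhdsWithin_le_nhds)
  · filter_upwards [prod_mem_prod self_mem_nhdsWithin self_mem_nhdsWithin] with p hp
    exact mul_ne_zero hp.1 hp.2

theorem tendsto_mixed_slope {u v : ℝ → ℂ} {u' v' : ℂ} (w : ℂ) (hu : HasDerivAt u u' 0)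
    (hv : HasDerivAt v v' 0) (hu0 : u 0 = 1) (hv0 : v 0 = 1) :
    Tendsto (fun p : ℝ × ℝ => ((p.1 * p.2 : ℝ) : ℂ)⁻¹ *
        (u p.1 * v p.2 * Complex.exp ((p.1 * p.2 : ℝ) * w) - u p.1 - v p.2 + 1))
      (𝓝[≠] 0 ×ˢ 𝓝[≠] 0) (𝓝 (u' * v' + w)) := by
  have hexp : HasDerivAt (fun t : ℝ => Complex.exp (t * w)) w 0 := by
    simpa using ((hasDerivAt_id (0 : ℝ)).ofReal_comp.mul_const w).cexp
  have hu1 : Tendsto u (𝓝[≠] 0) (𝓝 1) := hu0 ▸ hu.continuousAt.continuousWithinAt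
  have hv1 : Tendsto v (𝓝[≠] 0) (𝓝 1) := hv0 ▸ hv.continuousAt.continuousWithinAt
  have hlim := (((hasDerivAt_iff_tendsto_slope.1 hu).comp tendsto_fst).mul
    ((hasDerivAt_iff_tendsto_slope.1 hv).comp tendsto_snd)).add
    (((hu1.comp tendsto_fst).mul (hv1.comp tendsto_snd)).mul
      ((hasDerivAt_iff_tendsto_slope.1 hexp).comp tendsto_mul_nhdsNE_zero))
  rw [one_mul, one_mul] at hlim
  refine hlim.congr' ?_
  filter_upwards [prod_mem_prod self_mem_nhdsWithin self_mem_nhdsWithin] with p hp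
  have h1 : (p.1 : ℂ) ≠ 0 := Complex.ofReal_ne_zero.2 hp.1
  have h2 : (p.2 : ℂ) ≠ 0 := Complex.ofReal_ne_zero.2 hp.2
  simp only [Function.comp_apply, slope_def_module, sub_zero, hu0, hv0, Complex.ofReal_zero,
    zero_mul, Complex.exp_zero, Complex.real_smul, Complex.ofReal_inv, Complex.ofReal_mul]
  field_simp
  ring

end Limits

section Moments

open Filter Topology

variable {ι : Type*} [Fintype ι] {ψ : Hilb ι} {d : Phase ι} {C : Matrix (ι ⊕ ι) (ι ⊕ ι) ℝ}

/-- The state `|ψ⟩⟨ψ|` is Gaussian with mean `d` and covariance matrix `C`, normalised to be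
symmetric. That `ψ` is a unit vector is the case `ξ = 0` of `char_eq`. -/
structure IsGaussianWith (ψ : Hilb ι) (d : Phase ι) (C : Matrix (ι ⊕ ι) (ι ⊕ ι) ℝ) : Prop where
  symm : C.IsSymm
  char_eq (ξ : Phase ι) : inner ℂ ψ (weyl ξ ψ) =
    Complex.exp (Complex.I * ((ξ ⬝ᵥ d : ℝ) : ℂ) - ((ξ ⬝ᵥ (C *ᵥ ξ) : ℝ) : ℂ) / 4)

theorem IsPureGaussian.exists_isGaussianWith (h : IsPureGaussian ψ) :
    ∃ d C, IsGaussianWith ψ d C := by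
  obtain ⟨-, d, C, hchar⟩ := h
  refine ⟨d, (1 / 2 : ℝ) • (C + Cᵀ), (isSymm_add_transpose_self C).smul _, fun ξ => ?_⟩
  have hquad : ξ ⬝ᵥ (((1 / 2 : ℝ) • (C + Cᵀ)) *ᵥ ξ) = ξ ⬝ᵥ (C *ᵥ ξ) := by
    rw [smul_mulVec, add_mulVec, dotProduct_smul, dotProduct_add, mulVec_transpose,
      dotProduct_comm ξ (ξ ᵥ* C), ← dotProduct_mulVec, smul_eq_mul]
    ring
  rw [hchar, hquad]

theorem IsGaussianWith.inner_self (h : IsGaussianWith ψ d C) : inner ℂ ψ ψ = 1 := by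
  simpa [weyl_zero] using h.char_eq 0

theorem IsGaussianWith.norm_eq_one (h : IsGaussianWith ψ d C) : ‖ψ‖ = 1 := by
  have hsq := norm_sq_eq_re_inner (𝕜 := ℂ) ψ
  rw [h.inner_self, RCLike.one_re] at hsq
  exact (pow_eq_one_iff_of_nonneg (norm_nonneg ψ) two_ne_zero).1 hsq

theorem IsGaussianWith.hasDerivAt_inner_weyl (h : IsGaussianWith ψ d C) (ξ : Phase ι) :
    HasDerivAt (fun t : ℝ => inner ℂ ψ (weyl (t • ξ) ψ)) (Complex.I * ((ξ ⬝ᵥ d : ℝ) : ℂ)) 0 := by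
  have hlin : HasDerivAt (fun t : ℝ => ((t * (ξ ⬝ᵥ d) : ℝ) : ℂ)) (ξ ⬝ᵥ d : ℝ) 0 := by
    simpa using ((hasDerivAt_id (0 : ℝ)).mul_const (ξ ⬝ᵥ d)).ofReal_comp
  have hquad : HasDerivAt (fun t : ℝ => ((t ^ 2 * (ξ ⬝ᵥ (C *ᵥ ξ)) : ℝ) : ℂ)) 0 0 := by
    simpa using ((hasDerivAt_pow 2 (0 : ℝ)).mul_const (ξ ⬝ᵥ (C *ᵥ ξ))).ofReal_comp
  have hexp := ((hlin.const_mul Complex.I).sub (hquad.div_const 4)).cexp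
  simp only [Pi.sub_apply, zero_mul, zero_pow two_ne_zero, Complex.ofReal_zero, mul_zero, zero_div,
    sub_zero, Complex.exp_zero, one_mul] at hexp
  refine hexp.congr_of_eventuallyEq (.of_forall fun t => ?_)
  simp only [h.char_eq, smul_dotProduct, dotProduct_smul, mulVec_smul, smul_eq_mul, ← mul_assoc, sq]

variable [DecidableEq ι] in
/-- The centred second moment `⟨(R_ξ - ⟨R_ξ⟩) (R_η - ⟨R_η⟩)⟩ = (ξ·Cη - i ξ·Jη) / 2` of a Gaussian
state with covariance matrix `C`, where `R_ξ = ξ·R`. -/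
def quantumCov (C : Matrix (ι ⊕ ι) (ι ⊕ ι) ℝ) (ξ η : Phase ι) : ℂ :=
  ((ξ ⬝ᵥ (C *ᵥ η) : ℝ) - Complex.I * (ξ ⬝ᵥ (J ι ℝ *ᵥ η) : ℝ)) / 2

variable [DecidableEq ι] in
theorem IsGaussianWith.inner_weyl_weyl (h : IsGaussianWith ψ d C) (ξ η : Phase ι) :
    inner ℂ (weyl ξ ψ) (weyl η ψ) =
      inner ℂ ψ (weyl (-ξ) ψ) * inner ℂ ψ (weyl η ψ) * Complex.exp (quantumCov C ξ η) := by
  have hsymm : η ⬝ᵥ (C *ᵥ ξ) = ξ ⬝ᵥ (C *ᵥ η) := by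
    rw [dotProduct_mulVec, ← mulVec_transpose, h.symm.eq, dotProduct_comm]
  rw [CV.inner_weyl_weyl, h.char_eq, h.char_eq, h.char_eq, ← Complex.exp_add, ← Complex.exp_add,
    ← Complex.exp_add]
  congr 1
  simp only [quantumCov, mulVec_sub, sub_dotProduct, dotProduct_sub, hsymm, mulVec_neg,
    neg_dotProduct, dotProduct_neg]
  push_cast
  ring

variable [DecidableEq ι] in
theorem IsGaussianWith.tendsto_inner_slope (h : IsGaussianWith ψ d C) (ξ η : Phase ι) :
    Tendsto (fun p : ℝ × ℝ => inner ℂ (slope (fun t : ℝ => weyl (t • ξ) ψ) 0 p.1)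
        (slope (fun t : ℝ => weyl (t • η) ψ) 0 p.2)) (𝓝[≠] 0 ×ˢ 𝓝[≠] 0)
      (𝓝 ((ξ ⬝ᵥ d : ℝ) * (η ⬝ᵥ d : ℝ) + quantumCov C ξ η)) := by
  have hlim := tendsto_mixed_slope (quantumCov C ξ η) (h.hasDerivAt_inner_weyl (-ξ))
    (h.hasDerivAt_inner_weyl η) (by simp [weyl_zero, h.norm_eq_one])
    (by simp [weyl_zero, h.norm_eq_one])
  have hval : Complex.I * ((-ξ ⬝ᵥ d : ℝ) : ℂ) * (Complex.I * ((η ⬝ᵥ d : ℝ) : ℂ)) =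
      (ξ ⬝ᵥ d : ℝ) * (η ⬝ᵥ d : ℝ) := by
    rw [neg_dotProduct, Complex.ofReal_neg]
    linear_combination (-((ξ ⬝ᵥ d : ℝ) : ℂ) * ((η ⬝ᵥ d : ℝ) : ℂ)) * Complex.I_sq
  rw [hval] at hlim
  refine hlim.congr fun p => ?_
  have hcov : quantumCov C (p.1 • ξ) (p.2 • η) = (p.1 * p.2 : ℝ) * quantumCov C ξ η := by
    simp only [quantumCov, smul_dotProduct, dotProduct_smul, mulVec_smul, smul_eq_mul]
    push_cast
    ring
  simp only [slope_def_module, sub_zero, zero_smul, weyl_zero, inner_smul_left_eq_smul,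
    inner_smul_right_eq_smul, inner_sub_left, inner_sub_right, h.inner_weyl_weyl, hcov,
    inner_weyl_left _ ψ ψ, h.inner_self, smul_neg, Complex.real_smul]
  push_cast
  ring

theorem IsGaussianWith.differentiableAt (h : IsGaussianWith ψ d C) (ξ : Phase ι) :
    DifferentiableAt ℝ (fun t : ℝ => weyl (t • ξ) ψ) 0 := by
  classical
  obtain ⟨φ, hφ⟩ := exists_tendsto_of_tendsto_inner (h.tendsto_inner_slope ξ ξ)
  exact (hasDerivAt_iff_tendsto_slope.2 hφ).differentiableAt

/-- The derivative at `0` of the orbit `t ↦ W(t ξ) ψ`, formally `i R_ξ ψ`. -/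
def orbitDeriv (ψ : Hilb ι) (ξ : Phase ι) : Hilb ι := deriv (fun t : ℝ => weyl (t • ξ) ψ) 0

theorem IsGaussianWith.tendsto_slope (h : IsGaussianWith ψ d C) (ξ : Phase ι) :
    Tendsto (slope (fun t : ℝ => weyl (t • ξ) ψ) 0) (𝓝[≠] 0) (𝓝 (orbitDeriv ψ ξ)) :=
  hasDerivAt_iff_tendsto_slope.1 (h.differentiableAt ξ).hasDerivAt

variable [DecidableEq ι] in
theorem IsGaussianWith.inner_orbitDeriv (h : IsGaussianWith ψ d C) (ξ η : Phase ι) :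
    inner ℂ (orbitDeriv ψ ξ) (orbitDeriv ψ η) =
      (ξ ⬝ᵥ d : ℝ) * (η ⬝ᵥ d : ℝ) + quantumCov C ξ η :=
  tendsto_nhds_unique (((h.tendsto_slope ξ).comp tendsto_fst).inner
    ((h.tendsto_slope η).comp tendsto_snd)) (h.tendsto_inner_slope ξ η)

theorem IsGaussianWith.inner_self_orbitDeriv (h : IsGaussianWith ψ d C) (ξ : Phase ι) :
    inner ℂ ψ (orbitDeriv ψ ξ) = Complex.I * ((ξ ⬝ᵥ d : ℝ) : ℂ) := by
  have hinner := ((innerSL ℂ ψ).restrictScalars ℝ).hasFDerivAt.comp_hasDerivAt 0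
    (h.differentiableAt ξ).hasDerivAt
  exact hinner.unique (h.hasDerivAt_inner_weyl ξ)

variable [DecidableEq ι]

theorem basisVec_dotProduct (k : ι ⊕ ι) (v : Phase ι) : basisVec k ⬝ᵥ v = v k :=
  single_one_dotProduct k v

theorem dotProduct_mulVec_basisVec (M : Matrix (ι ⊕ ι) (ι ⊕ ι) ℝ) (k l : ι ⊕ ι) :
    basisVec k ⬝ᵥ (M *ᵥ basisVec l) = M k l := by
  simp [basisVec]

theorem IsGaussianWith.inner_quad (h : IsGaussianWith ψ d C) (k l : ι ⊕ ι) :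
    inner ℂ (quad k ψ) (quad l ψ) = d k * d l + (C k l - Complex.I * J ι ℝ k l) / 2 := by
  have hinner := h.inner_orbitDeriv (basisVec k) (basisVec l)
  rw [quantumCov, dotProduct_mulVec_basisVec, dotProduct_mulVec_basisVec, basisVec_dotProduct,
    basisVec_dotProduct] at hinner
  rw [← hinner, quad, quad, inner_smul_left, inner_smul_right, ← mul_assoc]
  simp [orbitDeriv]

theorem IsGaussianWith.firstMoment_eq (h : IsGaussianWith ψ d C) : firstMoment ψ = d := by
  funext k
  have hinner := h.inner_self_orbitDeriv (basisVec k)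
  rw [orbitDeriv, basisVec_dotProduct] at hinner
  simp [firstMoment, quad, inner_smul_right, hinner]

theorem IsGaussianWith.covMatrix_eq (h : IsGaussianWith ψ d C) : covMatrix ψ = C := by
  ext k l
  simp [covMatrix, h.firstMoment_eq, h.inner_quad, h.symm.apply k l]
  ring

theorem IsGaussianWith.energy_eq (h : IsGaussianWith ψ d C) :
    energy ψ = ENNReal.ofReal (C.trace / 4 + d ⬝ᵥ d / 2) := by
  have hnorm (k : ι ⊕ ι) : ‖quad k ψ‖ ^ 2 = d k * d k + C k k / 2 := by
    rw [norm_sq_eq_re_inner (𝕜 := ℂ), h.inner_quad]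
    simp
  have hdom (k : ι ⊕ ι) : InDomain k ψ := h.differentiableAt (basisVec k)
  rw [energy, if_pos hdom]
  congr 1
  simp only [hnorm, Finset.sum_add_distrib, dotProduct, Matrix.trace, Matrix.diag_apply,
    ← Finset.sum_div]
  ring

theorem IsGaussianWith.inner_centred (h : IsGaussianWith ψ d C) (ξ η : Phase ι) :
    inner ℂ (orbitDeriv ψ ξ - (Complex.I * (ξ ⬝ᵥ d : ℝ)) • ψ)
      (orbitDeriv ψ η - (Complex.I * (η ⬝ᵥ d : ℝ)) • ψ) = quantumCov C ξ η := by
  have hconj : inner ℂ (orbitDeriv ψ ξ) ψ = -Complex.I * (ξ ⬝ᵥ d : ℝ) := by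
    rw [← inner_conj_symm, h.inner_self_orbitDeriv, map_mul, Complex.conj_I, Complex.conj_ofReal]
  simp only [inner_sub_left, inner_sub_right, inner_smul_left, inner_smul_right, hconj,
    h.inner_orbitDeriv, h.inner_self_orbitDeriv, h.inner_self, map_mul, Complex.conj_I,
    Complex.conj_ofReal]
  linear_combination (((ξ ⬝ᵥ d : ℝ) : ℂ) * ((η ⬝ᵥ d : ℝ) : ℂ)) * Complex.I_sq

omit [DecidableEq ι] in
theorem IsGaussianWith.posDef (h : IsGaussianWith ψ d C) : C.PosDef := by
  classical
  refine Matrix.PosDef.of_dotProduct_mulVec_pos (by simpa using h.symm) fun ξ hξ => ?_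
  set φ := orbitDeriv ψ ξ - (Complex.I * (ξ ⬝ᵥ d : ℝ)) • ψ
  have hnorm : ‖φ‖ ^ 2 = ξ ⬝ᵥ (C *ᵥ ξ) / 2 := by
    rw [norm_sq_eq_re_inner (𝕜 := ℂ), h.inner_centred, quantumCov]
    simp
  have hφ : φ ≠ 0 := fun h0 => hξ <| by
    have hJ := congrArg Complex.im (h.inner_centred ξ (J ι ℝ *ᵥ ξ))
    rw [show orbitDeriv ψ ξ - _ = 0 from h0, inner_zero_left, quantumCov,
      mulVec_mulVec ξ (J ι ℝ), J_squared] at hJ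
    exact dotProduct_self_eq_zero.1 (by simpa [neg_mulVec] using hJ.symm)
  rw [star_trivial]
  linarith [sq_pos_of_pos (norm_pos_iff.2 hφ)]

end Moments

/-! ### Gaussian wave functions -/

section Wigner

variable {ι : Type*} [Fintype ι]

theorem inner_eq_integral (ψ φ : Hilb ι) :
    inner ℂ ψ φ = ∫ x, (starRingEnd ℂ) (ψ x) * φ x := by
  simp only [L2.inner_def, RCLike.inner_apply, mul_comm]

theorem integrable_conj_mul (ψ φ : Hilb ι) : Integrable fun x => (starRingEnd ℂ) (ψ x) * φ x := by
  simpa only [RCLike.inner_apply, mul_comm] using L2.integrable_inner (𝕜 := ℂ) ψ φ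

/-- Shifting both factors symmetrically absorbs the phase `exp (i a·b/2)` of the Weyl operator. -/
theorem inner_weyl_eq_integral (ψ φ : Hilb ι) (ξ : Phase ι) :
    inner ℂ ψ (weyl ξ φ) = ∫ y, Complex.exp (Complex.I * ((posPart ξ ⬝ᵥ y : ℝ) : ℂ)) *
      ((starRingEnd ℂ) (ψ (y - (1 / 2 : ℝ) • momPart ξ)) * φ (y + (1 / 2 : ℝ) • momPart ξ)) := by
  have hweyl : inner ℂ ψ (weyl ξ φ) = ∫ x, (starRingEnd ℂ) (ψ x) * weylFun ξ φ x := by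
    rw [inner_eq_integral]
    refine integral_congr_ae ?_
    filter_upwards [coeFn_weyl ξ φ] with x hx
    rw [hx]
  rw [hweyl, ← integral_sub_right_eq_self _ ((1 / 2 : ℝ) • momPart ξ)]
  congr 1 with y
  have hshift : y - (1 / 2 : ℝ) • momPart ξ + momPart ξ = y + (1 / 2 : ℝ) • momPart ξ := by
    module
  have hphase : posPart ξ ⬝ᵥ (y - (1 / 2 : ℝ) • momPart ξ) + posPart ξ ⬝ᵥ momPart ξ / 2 =
      posPart ξ ⬝ᵥ y := by
    rw [dotProduct_sub, dotProduct_smul, smul_eq_mul]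
    ring
  rw [weylFun, hshift, hphase, mul_left_comm]

theorem dense_span_weyl {ψ : Hilb ι} (hψ : ∀ᵐ x, ψ x ≠ 0) :
    Dense (Submodule.span ℂ (Set.range fun ξ => weyl ξ ψ) : Set (Hilb ι)) := by
  rw [Submodule.dense_iff_topologicalClosure_eq_top, Submodule.topologicalClosure_eq_top_iff,
    Submodule.eq_bot_iff]
  intro φ hφ
  have hzero := ae_eq_zero_of_integral_exp_dotProduct_mul_eq_zero (integrable_conj_mul φ ψ)
    fun a => by
      have horth : inner ℂ φ (weyl (Sum.elim a 0) ψ) = 0 :=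
        Submodule.inner_left_of_mem_orthogonal
          (Submodule.subset_span (Set.mem_range_self (Sum.elim a 0))) hφ
      have hpos : posPart (Sum.elim a 0 : Phase ι) = a := rfl
      have hmom : momPart (Sum.elim a 0 : Phase ι) = 0 := rfl
      simpa only [inner_weyl_eq_integral, hpos, hmom, smul_zero, sub_zero, add_zero] using horth
  apply Lp.ext
  filter_upwards [hzero, hψ, Lp.coeFn_zero ℂ 2 (volume : Measure (ι → ℝ))] with x hφψ hx h0
  simpa [h0, hx] using hφψ

end Wigner

section GaussianIntegral

variable {ι : Type*} [Fintype ι]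

theorem integral_exp_dotProduct_mul_exp_neg_dotProduct_self (w : ι → ℝ) :
    ∫ y : ι → ℝ, Complex.exp (Complex.I * ((w ⬝ᵥ y : ℝ) : ℂ)) * (Real.exp (-(y ⬝ᵥ y)) : ℂ) =
      (Real.pi ^ (Fintype.card ι / 2 : ℝ) : ℝ) * Complex.exp (-((w ⬝ᵥ w : ℝ) : ℂ) / 4) := by
  have h := GaussianFourier.integral_cexp_neg_mul_sum_add (b := 1) (by simp)
    (fun i => Complex.I * (w i : ℂ))
  have hleft (y : ι → ℝ) : -1 * ∑ i, (y i : ℂ) ^ 2 + ∑ i, Complex.I * (w i : ℂ) * (y i : ℂ) =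
      Complex.I * ((w ⬝ᵥ y : ℝ) : ℂ) + ((-(y ⬝ᵥ y) : ℝ) : ℂ) := by
    simp [dotProduct, Finset.mul_sum, mul_assoc, sq, add_comm]
  have hright : ∑ i, (Complex.I * (w i : ℂ)) ^ 2 = -((w ⬝ᵥ w : ℝ) : ℂ) := by
    simp_rw [mul_pow, Complex.I_sq, neg_one_mul, Finset.sum_neg_distrib]
    simp [dotProduct, sq]
  simp only [hleft, hright, Complex.exp_add, div_one, mul_one] at h
  simpa [Complex.ofReal_cpow Real.pi_pos.le] using h

variable [DecidableEq ι]

theorem integral_comp_mulVec {E : Type*} [NormedAddCommGroup E] [NormedSpace ℝ E]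
    {M : Matrix ι ι ℝ} (hM : IsUnit M.det) (f : (ι → ℝ) → E) :
    ∫ x, f (M *ᵥ x) = |M.det|⁻¹ • ∫ x, f x := by
  have hemb : MeasurableEmbedding (toLin' M) :=
    (LinearMap.equivOfDetNeZero (toLin' M) (by simpa using hM.ne_zero)
      ).toContinuousLinearEquiv.toHomeomorph.measurableEmbedding
  have hmap := hemb.integral_map (μ := volume) f
  rw [Real.map_matrix_volume_pi_eq_smul_volume_pi hM.ne_zero, integral_smul_measure,
    ENNReal.toReal_ofReal (abs_nonneg _), abs_inv] at hmap
  simpa using hmap.symm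

/-- The integral of the Gaussian `x ↦ exp (-|K⁻¹ x|²)`. -/
def gaussIntegral (K : Matrix ι ι ℝ) : ℝ := |K.det| * Real.pi ^ (Fintype.card ι / 2 : ℝ)

theorem gaussIntegral_pos {K : Matrix ι ι ℝ} (hK : IsUnit K.det) : 0 < gaussIntegral K :=
  mul_pos (abs_pos.2 hK.ne_zero) (Real.rpow_pos_of_pos Real.pi_pos _)

theorem integral_exp_dotProduct_mul_gaussian {K : Matrix ι ι ℝ} (hK : IsUnit K.det) (w : ι → ℝ) :
    ∫ x : ι → ℝ, Complex.exp (Complex.I * ((w ⬝ᵥ x : ℝ) : ℂ)) *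
        (Real.exp (-((K⁻¹ *ᵥ x) ⬝ᵥ (K⁻¹ *ᵥ x))) : ℂ) =
      gaussIntegral K * Complex.exp (-(((Kᵀ *ᵥ w) ⬝ᵥ (Kᵀ *ᵥ w) : ℝ) : ℂ) / 4) := by
  have hpair (x : ι → ℝ) : (Kᵀ *ᵥ w) ⬝ᵥ (K⁻¹ *ᵥ x) = w ⬝ᵥ x := by
    rw [mulVec_transpose, ← dotProduct_mulVec, mulVec_mulVec, mul_nonsing_inv _ hK, one_mulVec]
  have hcomp := integral_comp_mulVec (isUnit_nonsing_inv_det K hK) fun y : ι → ℝ =>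
    Complex.exp (Complex.I * (((Kᵀ *ᵥ w) ⬝ᵥ y : ℝ) : ℂ)) * (Real.exp (-(y ⬝ᵥ y)) : ℂ)
  simp only [hpair, integral_exp_dotProduct_mul_exp_neg_dotProduct_self] at hcomp
  rw [hcomp, det_nonsing_inv, Ring.inverse_eq_inv', abs_inv, inv_inv, gaussIntegral,
    Complex.real_smul, Complex.ofReal_mul, mul_assoc]

theorem integrable_gaussian {K : Matrix ι ι ℝ} (hK : IsUnit K.det) :
    Integrable fun x : ι → ℝ => Real.exp (-((K⁻¹ *ᵥ x) ⬝ᵥ (K⁻¹ *ᵥ x))) := by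
  have hint := integral_exp_dotProduct_mul_gaussian hK 0
  simp only [zero_dotProduct, mulVec_zero, Complex.ofReal_zero, mul_zero, neg_zero, zero_div,
    Complex.exp_zero, one_mul, mul_one, integral_complex_ofReal] at hint
  refine Integrable.of_integral_ne_zero ?_
  rw [Complex.ofReal_injective hint]
  exact (gaussIntegral_pos hK).ne'

end GaussianIntegral

section GaussianVectors

variable {ι : Type*} [Fintype ι] [DecidableEq ι]

/-- The Gaussian wave function `x ↦ exp (-|K⁻¹ x|²/2 + i x·Xx/2)`, not normalised; it serves to
realise every symplectic positive definite matrix as a covariance matrix. -/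
def gaussFun (K X : Matrix ι ι ℝ) (x : ι → ℝ) : ℂ :=
  Complex.exp (-(((K⁻¹ *ᵥ x) ⬝ᵥ (K⁻¹ *ᵥ x) / 2 : ℝ) : ℂ)
    + Complex.I * ((x ⬝ᵥ (X *ᵥ x) / 2 : ℝ) : ℂ))

theorem continuous_gaussFun (K X : Matrix ι ι ℝ) : Continuous (gaussFun K X) := by
  unfold gaussFun
  fun_prop

theorem memLp_gaussFun {K : Matrix ι ι ℝ} (hK : IsUnit K.det) (X : Matrix ι ι ℝ) :
    MemLp (gaussFun K X) 2 volume := by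
  have hnorm (x : ι → ℝ) : ‖gaussFun K X x‖ ^ 2 = Real.exp (-((K⁻¹ *ᵥ x) ⬝ᵥ (K⁻¹ *ᵥ x))) := by
    rw [gaussFun, Complex.norm_exp, ← Real.exp_nat_mul]
    simp [mul_div_cancel₀]
  rw [memLp_two_iff_integrable_sq_norm (continuous_gaussFun K X).aestronglyMeasurable]
  simpa only [hnorm] using integrable_gaussian hK

/-- The vector with wave function `gaussFun K X`. -/
def gaussVec {K : Matrix ι ι ℝ} (hK : IsUnit K.det) (X : Matrix ι ι ℝ) : Hilb ι :=
  (memLp_gaussFun hK X).toLp (gaussFun K X)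

theorem coeFn_gaussVec {K : Matrix ι ι ℝ} (hK : IsUnit K.det) (X : Matrix ι ι ℝ) :
    gaussVec hK X =ᵐ[volume] gaussFun K X := MemLp.coeFn_toLp _

theorem conj_gaussFun_mul_gaussFun (K : Matrix ι ι ℝ) {X : Matrix ι ι ℝ} (hX : X.IsSymm)
    (x b : ι → ℝ) :
    (starRingEnd ℂ) (gaussFun K X (x - (1 / 2 : ℝ) • b)) * gaussFun K X (x + (1 / 2 : ℝ) • b) =
      Complex.exp (-(((K⁻¹ *ᵥ b) ⬝ᵥ (K⁻¹ *ᵥ b) : ℝ) : ℂ) / 4) *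
        (Complex.exp (Complex.I * (((X *ᵥ b) ⬝ᵥ x : ℝ) : ℂ)) *
          (Real.exp (-((K⁻¹ *ᵥ x) ⬝ᵥ (K⁻¹ *ᵥ x))) : ℂ)) := by
  have hXs : b ⬝ᵥ (X *ᵥ x) = x ⬝ᵥ (X *ᵥ b) := by
    rw [dotProduct_mulVec, ← mulVec_transpose, hX.eq, dotProduct_comm]
  rw [gaussFun, gaussFun, ← Complex.exp_conj, Complex.ofReal_exp, ← Complex.exp_add,
    ← Complex.exp_add, ← Complex.exp_add]
  simp only [map_add, map_neg, map_mul, Complex.conj_ofReal, Complex.conj_I]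
  congr 1
  simp only [mulVec_add, mulVec_sub, mulVec_smul, dotProduct_add, dotProduct_sub, add_dotProduct,
    sub_dotProduct, dotProduct_smul, smul_dotProduct, smul_eq_mul, hXs,
    dotProduct_comm (X *ᵥ b) x, dotProduct_comm (K⁻¹ *ᵥ b) (K⁻¹ *ᵥ x)]
  push_cast
  ring

theorem inner_weyl_gaussVec {K X : Matrix ι ι ℝ} (hK : IsUnit K.det) (hX : X.IsSymm)
    (ξ : Phase ι) :
    inner ℂ (gaussVec hK X) (weyl ξ (gaussVec hK X)) =
      gaussIntegral K * Complex.exp (-(((Kᵀ *ᵥ (posPart ξ + X *ᵥ momPart ξ)) ⬝ᵥ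
          (Kᵀ *ᵥ (posPart ξ + X *ᵥ momPart ξ)) +
        (K⁻¹ *ᵥ momPart ξ) ⬝ᵥ (K⁻¹ *ᵥ momPart ξ) : ℝ) : ℂ) / 4) := by
  set a := posPart ξ with ha
  set b := momPart ξ with hb
  have hkernel : inner ℂ (gaussVec hK X) (weyl ξ (gaussVec hK X)) =
      ∫ x, Complex.exp (-(((K⁻¹ *ᵥ b) ⬝ᵥ (K⁻¹ *ᵥ b) : ℝ) : ℂ) / 4) *
        (Complex.exp (Complex.I * (((a + X *ᵥ b) ⬝ᵥ x : ℝ) : ℂ)) *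
          (Real.exp (-((K⁻¹ *ᵥ x) ⬝ᵥ (K⁻¹ *ᵥ x))) : ℂ)) := by
    rw [inner_weyl_eq_integral]
    refine integral_congr_ae ?_
    filter_upwards [(measurePreserving_sub_right volume ((1 / 2 : ℝ) • b)
      ).quasiMeasurePreserving.ae_eq_comp (coeFn_gaussVec hK X),
      (measurePreserving_add_right volume ((1 / 2 : ℝ) • b)
      ).quasiMeasurePreserving.ae_eq_comp (coeFn_gaussVec hK X)] with x hsub hadd
    simp only [Function.comp_apply] at hsub hadd
    rw [← ha, ← hb, hsub, hadd, conj_gaussFun_mul_gaussFun K hX, add_dotProduct, Complex.ofReal_add,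
      mul_add, Complex.exp_add]
    ring
  rw [hkernel, integral_const_mul, integral_exp_dotProduct_mul_gaussian hK, mul_left_comm,
    ← Complex.exp_add]
  congr 2
  push_cast
  ring

omit [DecidableEq ι] in
theorem isGaussianWith_inv_sqrt_smul {φ : Hilb ι} {C : Matrix (ι ⊕ ι) (ι ⊕ ι) ℝ} (hC : C.IsSymm)
    {z : ℝ} (hz : 0 < z) (h : ∀ ξ : Phase ι, inner ℂ φ (weyl ξ φ) =
      z * Complex.exp (-((ξ ⬝ᵥ (C *ᵥ ξ) : ℝ) : ℂ) / 4)) :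
    IsGaussianWith (((√z)⁻¹ : ℂ) • φ) 0 C where
  symm := hC
  char_eq ξ := by
    have hsq : ((√z : ℂ))⁻¹ * ((√z : ℂ))⁻¹ * z = 1 := by
      rw [← mul_inv, ← Complex.ofReal_mul, Real.mul_self_sqrt hz.le,
        inv_mul_cancel₀ (Complex.ofReal_ne_zero.2 hz.ne')]
    rw [weyl_smul, inner_smul_left, inner_smul_right, h, map_inv₀, Complex.conj_ofReal, ← mul_assoc,
      ← mul_assoc, hsq, one_mul, dotProduct_zero]
    simp [neg_div]

theorem exists_isSymm_fromBlocks_eq {n R : Type*} [Fintype n] [DecidableEq n] [CommRing R]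
    {A B B' D : Matrix n n R} (hsymm : (fromBlocks A B B' D).IsSymm)
    (hmem : fromBlocks A B B' D ∈ symplecticGroup n R) (hA : IsUnit A.det) :
    ∃ X : Matrix n n R, X.IsSymm ∧
      fromBlocks A B B' D = fromBlocks A (A * X) (X * A) (A⁻¹ + X * A * X) := by
  rw [IsSymm, fromBlocks_transpose, fromBlocks_inj] at hsymm
  obtain ⟨hAs, hB', hB, -⟩ := hsymm
  rw [SymplecticGroup.fromBlocks_mem_iff, hAs, hB'] at hmem
  obtain ⟨hAB, -, hdet⟩ := hmem
  have hX : B' * A⁻¹ = A⁻¹ * B := by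
    rw [← nonsing_inv_mul_cancel_left A (B' * A⁻¹) hA, ← Matrix.mul_assoc A, hAB,
      mul_nonsing_inv_cancel_right _ _ hA]
  have hAX : A * (A⁻¹ * B) = B := mul_nonsing_inv_cancel_left _ _ hA
  refine ⟨A⁻¹ * B, ?_, ?_⟩
  · rw [IsSymm, transpose_mul, transpose_nonsing_inv, hAs, hB, hX]
  · have hXA : A⁻¹ * B * A = B' := by rw [← hX, nonsing_inv_mul_cancel_right _ _ hA]
    have hD : A⁻¹ + B' * (A⁻¹ * B) = D := by
      rw [← Matrix.mul_assoc, hX, Matrix.mul_assoc, ← nonsing_inv_mul_cancel_left A D hA,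
        sub_eq_iff_eq_add.1 hdet, Matrix.mul_add, Matrix.mul_one]
    rw [hAX, hXA, hD]

theorem dotProduct_fromBlocks_mulVec_self {K X : Matrix ι ι ℝ} (hX : X.IsSymm) (ξ : Phase ι) :
    ξ ⬝ᵥ (fromBlocks (K * Kᵀ) (K * Kᵀ * X) (X * (K * Kᵀ)) ((K * Kᵀ)⁻¹ + X * (K * Kᵀ) * X) *ᵥ ξ) =
      (Kᵀ *ᵥ (posPart ξ + X *ᵥ momPart ξ)) ⬝ᵥ (Kᵀ *ᵥ (posPart ξ + X *ᵥ momPart ξ)) +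
        (K⁻¹ *ᵥ momPart ξ) ⬝ᵥ (K⁻¹ *ᵥ momPart ξ) := by
  have hξ : ξ = Sum.elim (posPart ξ) (momPart ξ) := (Sum.elim_comp_inl_inr ξ).symm
  have hmul (M N : Matrix ι ι ℝ) (u v : ι → ℝ) :
      (M *ᵥ u) ⬝ᵥ (N *ᵥ v) = u ⬝ᵥ ((Mᵀ * N) *ᵥ v) := by
    rw [← mulVec_mulVec, dotProduct_mulVec u, vecMul_transpose]
  have hX' (u v : ι → ℝ) : (X *ᵥ u) ⬝ᵥ v = u ⬝ᵥ (X *ᵥ v) := by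
    rw [dotProduct_mulVec, ← mulVec_transpose, hX.eq]
  conv_lhs => rw [hξ]
  rw [fromBlocks_mulVec, sumElim_dotProduct_sumElim, hmul, hmul, transpose_transpose,
    transpose_nonsing_inv, ← Matrix.mul_inv_rev]
  simp only [Sum.elim_comp_inl, Sum.elim_comp_inr, mulVec_add, add_mulVec, dotProduct_add,
    add_dotProduct, hX', mulVec_mulVec, Matrix.mul_assoc]
  ring

theorem exists_isGaussianWith_mul_transpose {S : Matrix (ι ⊕ ι) (ι ⊕ ι) ℝ}
    (hS : S ∈ symplecticGroup ι ℝ) :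
    ∃ ψ : Hilb ι, IsGaussianWith ψ 0 (S * Sᵀ) ∧
      Dense (Submodule.span ℂ (Set.range fun ξ => weyl ξ ψ) : Set (Hilb ι)) := by
  have hmem : S * Sᵀ ∈ symplecticGroup ι ℝ := mul_mem hS (SymplecticGroup.transpose_mem hS)
  have hsymm : (S * Sᵀ).IsSymm := isSymm_mul_transpose_self S
  have hpos : (S * Sᵀ).PosDef := by
    simpa using posDef_mul_mul_transpose PosDef.one (isUnit_of_mem_symplecticGroup hS)
  obtain ⟨K, hK, hAK⟩ := exists_eq_mul_transpose_of_posDef (hpos.submatrix Sum.inl_injective)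
  obtain ⟨X, hX, hSX⟩ : ∃ X : Matrix ι ι ℝ, X.IsSymm ∧ S * Sᵀ = fromBlocks (K * Kᵀ)
      (K * Kᵀ * X) (X * (K * Kᵀ)) ((K * Kᵀ)⁻¹ + X * (K * Kᵀ) * X) := by
    have hdet : IsUnit (K * Kᵀ).det := by
      simpa using (isUnit_iff_isUnit_det K).1 hK
    have hblocks := (fromBlocks_toBlocks (S * Sᵀ)).symm
    rw [show (S * Sᵀ).toBlocks₁₁ = K * Kᵀ from hAK] at hblocks
    rw [hblocks] at hsymm hmem ⊢
    exact exists_isSymm_fromBlocks_eq hsymm hmem hdet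
  have hK' := (isUnit_iff_isUnit_det K).1 hK
  refine ⟨((√(gaussIntegral K))⁻¹ : ℂ) • gaussVec hK' X,
    isGaussianWith_inv_sqrt_smul hsymm (gaussIntegral_pos hK') fun ξ => ?_, dense_span_weyl ?_⟩
  · rw [hSX, dotProduct_fromBlocks_mulVec_self hX, inner_weyl_gaussVec hK' hX]
  · filter_upwards [coeFn_gaussVec hK' X, Lp.coeFn_smul ((√(gaussIntegral K))⁻¹ : ℂ)
      (gaussVec hK' X)] with x hx hsmul
    rw [hsmul, Pi.smul_apply, hx]
    exact smul_ne_zero (inv_ne_zero (Complex.ofReal_ne_zero.2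
      (Real.sqrt_pos.2 (gaussIntegral_pos hK')).ne')) (Complex.exp_ne_zero _)

end GaussianVectors

/-! ### Gaussian unitaries -/

section Unitaries

variable {ι : Type*} [Fintype ι] {U : Hilb ι ≃ₗᵢ[ℂ] Hilb ι}
  {S : Matrix (ι ⊕ ι) (ι ⊕ ι) ℝ} {s : Phase ι}

/-- The unitary `U` implements the affine map `R ↦ S R + s` of the quadratures in the Heisenberg
picture; it is Gaussian if `S` is symplectic. -/
def Implements (U : Hilb ι ≃ₗᵢ[ℂ] Hilb ι) (S : Matrix (ι ⊕ ι) (ι ⊕ ι) ℝ) (s : Phase ι) : Prop :=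
  ∀ (ξ : Phase ι) (ψ : Hilb ι), U.symm (weyl ξ (U ψ)) =
    Complex.exp (Complex.I * ((ξ ⬝ᵥ s : ℝ) : ℂ)) • weyl (Sᵀ *ᵥ ξ) ψ

theorem Implements.weyl_map (hU : Implements U S s) (ξ : Phase ι) (ψ : Hilb ι) :
    weyl ξ (U ψ) = Complex.exp (Complex.I * ((ξ ⬝ᵥ s : ℝ) : ℂ)) • U (weyl (Sᵀ *ᵥ ξ) ψ) := by
  rw [← map_smul, ← hU, U.apply_symm_apply]

theorem Implements.of_dense_span {α : Type*} {v : α → Hilb ι}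
    (hv : Dense (Submodule.span ℂ (Set.range v) : Set (Hilb ι)))
    (h : ∀ ξ i, weyl ξ (U (v i)) =
      Complex.exp (Complex.I * ((ξ ⬝ᵥ s : ℝ) : ℂ)) • U (weyl (Sᵀ *ᵥ ξ) (v i))) :
    Implements U S s := by
  intro ξ ψ
  have hext : ((U.trans (weylEquiv ξ)).trans U.symm : Hilb ι →L[ℂ] Hilb ι) =
      Complex.exp (Complex.I * ((ξ ⬝ᵥ s : ℝ) : ℂ)) •
        (weylEquiv (Sᵀ *ᵥ ξ) : Hilb ι →L[ℂ] Hilb ι) := by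
    refine ContinuousLinearMap.ext_on hv ?_
    rintro _ ⟨i, rfl⟩
    change U.symm (weyl ξ (U (v i))) = (_ : ℂ) • weyl (Sᵀ *ᵥ ξ) (v i)
    rw [h, map_smul, U.symm_apply_apply]
  exact congrArg (fun f : Hilb ι →L[ℂ] Hilb ι => f ψ) hext

theorem transpose_mulVec_dotProduct_mulVec {n : Type*} [Fintype n] (S C : Matrix n n ℝ)
    (ξ η : n → ℝ) : (Sᵀ *ᵥ ξ) ⬝ᵥ (C *ᵥ (Sᵀ *ᵥ η)) = ξ ⬝ᵥ ((S * C * Sᵀ) *ᵥ η) := by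
  rw [mulVec_transpose, ← dotProduct_mulVec, mulVec_mulVec, mulVec_mulVec, Matrix.mul_assoc]

theorem IsGaussianWith.map {ψ : Hilb ι} {d : Phase ι} {C : Matrix (ι ⊕ ι) (ι ⊕ ι) ℝ}
    (h : IsGaussianWith ψ d C) (hU : Implements U S s) :
    IsGaussianWith (U ψ) (S *ᵥ d + s) (S * C * Sᵀ) where
  symm := by simp only [IsSymm, transpose_mul, transpose_transpose, h.symm.eq, Matrix.mul_assoc]
  char_eq ξ := by
    rw [hU.weyl_map, inner_smul_right, U.inner_map_map, h.char_eq, ← Complex.exp_add,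
      transpose_mulVec_dotProduct_mulVec, mulVec_transpose, ← dotProduct_mulVec, dotProduct_add]
    congr 1
    push_cast
    ring

variable [DecidableEq ι]

theorem dotProduct_J_mulVec_transpose_mulVec (hS : S ∈ symplecticGroup ι ℝ) (ξ η : Phase ι) :
    (Sᵀ *ᵥ ξ) ⬝ᵥ (J ι ℝ *ᵥ (Sᵀ *ᵥ η)) = ξ ⬝ᵥ (J ι ℝ *ᵥ η) := by
  rw [transpose_mulVec_dotProduct_mulVec, SymplecticGroup.mem_iff.1 hS]

/-- The orbits of the ground state under `ξ ↦ W(Sᵀ ξ)` and of the Gaussian vector with covariance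
`S Sᵀ` under `W` have the same Gram matrix, so that a unitary carries one onto the other. -/
theorem exists_implements_zero (hS : S ∈ symplecticGroup ι ℝ) :
    ∃ U : Hilb ι ≃ₗᵢ[ℂ] Hilb ι, Implements U S 0 := by
  obtain ⟨v, hv, hv_dense⟩ := exists_isGaussianWith_mul_transpose (ι := ι) (one_mem _)
  obtain ⟨w, hw, hw_dense⟩ := exists_isGaussianWith_mul_transpose hS
  have hsurj : Function.Surjective fun ξ : Phase ι => Sᵀ *ᵥ ξ :=
    mulVec_surjective_iff_isUnit.2
      (isUnit_of_mem_symplecticGroup (SymplecticGroup.transpose_mem hS))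
  rw [← hsurj.range_comp] at hv_dense
  obtain ⟨U, hU⟩ := exists_linearIsometryEquiv_of_inner_eq hv_dense hw_dense fun ξ η => by
    simp only [Function.comp_apply]
    rw [inner_weyl_weyl, inner_weyl_weyl, dotProduct_J_mulVec_transpose_mulVec hS, hv.char_eq,
      hw.char_eq, ← mulVec_sub, transpose_mulVec_dotProduct_mulVec, transpose_one, Matrix.mul_one,
      Matrix.mul_one, dotProduct_zero, dotProduct_zero]
  refine ⟨U, .of_dense_span hv_dense fun ξ η => ?_⟩
  have hadd := hU (ξ + η)
  simp only [Function.comp_apply] at hU hadd ⊢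
  rw [hU, weyl_weyl, weyl_weyl, dotProduct_J_mulVec_transpose_mulVec hS, ← mulVec_add, map_smul,
    hadd]
  simp

theorem Implements.trans_weylEquiv (hU : Implements U S 0) (s : Phase ι) :
    Implements (U.trans (weylEquiv (-(J ι ℝ *ᵥ s)))) S s := by
  intro ξ ψ
  set η := -(J ι ℝ *ᵥ s) with hη
  have hJη : J ι ℝ *ᵥ η = s := by
    rw [hη, mulVec_neg, mulVec_mulVec, J_squared, neg_mulVec, one_mulVec, neg_neg]
  have hanti : η ⬝ᵥ (J ι ℝ *ᵥ ξ) = -(ξ ⬝ᵥ (J ι ℝ *ᵥ η)) := by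
    rw [dotProduct_mulVec, ← mulVec_transpose, J_transpose, neg_mulVec, neg_dotProduct,
      dotProduct_comm]
  change U.symm (weyl (-η) (weyl ξ (weyl η (U ψ)))) = _
  rw [weyl_weyl ξ η, weyl_smul, weyl_weyl, neg_add_cancel_comm_assoc, map_smul, map_smul, hU,
    smul_smul, smul_smul]
  congr 1
  rw [← Complex.exp_add, ← Complex.exp_add, mulVec_add, dotProduct_add, neg_dotProduct η,
    neg_dotProduct η, dotProduct_J_mulVec_self, hanti, hJη]
  congr 1
  simp
  ring

theorem exists_implements (hS : S ∈ symplecticGroup ι ℝ) (s : Phase ι) :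
    ∃ U : Hilb ι ≃ₗᵢ[ℂ] Hilb ι, Implements U S s := by
  obtain ⟨U, hU⟩ := exists_implements_zero hS
  exact ⟨_, hU.trans_weylEquiv s⟩

end Unitaries

/-! ### Covariance matrices of pure states -/

section Purity

variable {ι : Type*} [Fintype ι]

theorem integrable_exp_dotProduct_mul (a : ι → ℝ) {f : (ι → ℝ) → ℂ} (hf : Integrable f) :
    Integrable fun y => Complex.exp (Complex.I * ((a ⬝ᵥ y : ℝ) : ℂ)) * f y := by
  refine hf.bdd_mul (c := 1) (by fun_prop) (Filter.Eventually.of_forall fun y => ?_)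
  rw [mul_comm, Complex.norm_exp_ofReal_mul_I]

theorem conj_mul_ae_eq_of_inner_weyl_eq_integral {ψ φ : Hilb ι} {b : ι → ℝ} {g : (ι → ℝ) → ℂ}
    (hg : Integrable g) (h : ∀ a : ι → ℝ, inner ℂ ψ (weyl (Sum.elim a b) φ) =
      ∫ y, Complex.exp (Complex.I * ((a ⬝ᵥ y : ℝ) : ℂ)) * g y) :
    ∀ᵐ y, (starRingEnd ℂ) (ψ (y - (1 / 2 : ℝ) • b)) * φ (y + (1 / 2 : ℝ) • b) = g y := by
  have hpos (a : ι → ℝ) : posPart (Sum.elim a b : Phase ι) = a := rfl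
  have hmom (a : ι → ℝ) : momPart (Sum.elim a b : Phase ι) = b := rfl
  simp only [inner_weyl_eq_integral, hpos, hmom] at h
  have htranslate : Integrable fun x => (starRingEnd ℂ) (ψ x) * φ (x + b) := by
    refine (integrable_conj_mul ψ (weyl (Sum.elim 0 b) φ)).congr ?_
    filter_upwards [coeFn_weyl (Sum.elim 0 b) φ] with x hx
    simp [hx, weylFun, hpos, hmom]
  have hkernel : Integrable fun y =>
      (starRingEnd ℂ) (ψ (y - (1 / 2 : ℝ) • b)) * φ (y + (1 / 2 : ℝ) • b) := by
    have hshift (y : ι → ℝ) : y - (1 / 2 : ℝ) • b + b = y + (1 / 2 : ℝ) • b := by module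
    simpa only [hshift] using htranslate.comp_sub_right ((1 / 2 : ℝ) • b)
  have hzero := ae_eq_zero_of_integral_exp_dotProduct_mul_eq_zero (hkernel.sub hg) fun a => by
    simp only [Pi.sub_apply, mul_sub]
    rw [integral_sub (integrable_exp_dotProduct_mul a hkernel) (integrable_exp_dotProduct_mul a hg),
      h, sub_self]
  filter_upwards [hzero] with y hy using sub_eq_zero.1 hy

variable [DecidableEq ι]

theorem IsGaussianWith.conj_mul_ae_eq {ψ : Hilb ι} {K M : Matrix ι ι ℝ} (hK : IsUnit K.det)
    (h : IsGaussianWith ψ 0 (fromBlocks (K * Kᵀ) 0 0 M)) (b : ι → ℝ) :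
    ∀ᵐ y, (starRingEnd ℂ) (ψ (y - (1 / 2 : ℝ) • b)) * ψ (y + (1 / 2 : ℝ) • b) =
      (((gaussIntegral K)⁻¹ * Real.exp (-(b ⬝ᵥ (M *ᵥ b)) / 4) *
        Real.exp (-((K⁻¹ *ᵥ y) ⬝ᵥ (K⁻¹ *ᵥ y))) : ℝ) : ℂ) := by
  refine conj_mul_ae_eq_of_inner_weyl_eq_integral
    ((integrable_gaussian hK).const_mul _).ofReal fun a => ?_
  have hquad : Sum.elim a b ⬝ᵥ (fromBlocks (K * Kᵀ) 0 0 M *ᵥ Sum.elim a b) =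
      (Kᵀ *ᵥ a) ⬝ᵥ (Kᵀ *ᵥ a) + b ⬝ᵥ (M *ᵥ b) := by
    have hK' : (Kᵀ *ᵥ a) ⬝ᵥ (Kᵀ *ᵥ a) = a ⬝ᵥ ((K * Kᵀ) *ᵥ a) := by
      rw [mulVec_transpose, ← dotProduct_mulVec, ← mulVec_transpose, mulVec_mulVec]
    rw [fromBlocks_mulVec, sumElim_dotProduct_sumElim, hK']
    simp
  have hz : (gaussIntegral K : ℂ) ≠ 0 := Complex.ofReal_ne_zero.2 (gaussIntegral_pos hK).ne'
  rw [h.char_eq, hquad]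
  simp_rw [Complex.ofReal_mul _ (Real.exp (-(_ ⬝ᵥ _))), mul_left_comm (Complex.exp _)]
  rw [integral_const_mul, integral_exp_dotProduct_mul_gaussian hK, Complex.ofReal_mul,
    Complex.ofReal_inv, mul_mul_mul_comm, inv_mul_cancel₀ hz, one_mul, Complex.ofReal_exp,
    ← Complex.exp_add, dotProduct_zero]
  congr 1
  push_cast
  ring

/-- Compare `|conj ψ(y - b/2) ψ(y + b/2)|²` with `|ψ(y - b/2)|² |ψ(y + b/2)|²` for `b = K u`. -/
theorem IsGaussianWith.mulVec_dotProduct_mulVec_mulVec {ψ : Hilb ι} {K M : Matrix ι ι ℝ}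
    (hK : IsUnit K.det) (h : IsGaussianWith ψ 0 (fromBlocks (K * Kᵀ) 0 0 M)) (u : ι → ℝ) :
    (K *ᵥ u) ⬝ᵥ (M *ᵥ (K *ᵥ u)) = u ⬝ᵥ u := by
  set b := (1 / 2 : ℝ) • (K *ᵥ u) with hb
  have hc : 0 < (gaussIntegral K)⁻¹ := inv_pos.2 (gaussIntegral_pos hK)
  have hdiag : ∀ᵐ y, ‖ψ y‖ ^ 2 =
      (gaussIntegral K)⁻¹ * Real.exp (-((K⁻¹ *ᵥ y) ⬝ᵥ (K⁻¹ *ᵥ y))) := by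
    filter_upwards [h.conj_mul_ae_eq hK 0] with y hy
    have hy' := congrArg norm hy
    rw [norm_mul, RCLike.norm_conj, Complex.norm_real, Real.norm_of_nonneg (by positivity)] at hy'
    simpa [sq] using hy'
  obtain ⟨y, hy, hsub, hadd⟩ := ((h.conj_mul_ae_eq hK (K *ᵥ u)).and
    (((measurePreserving_sub_right volume b).quasiMeasurePreserving.ae hdiag).and
      ((measurePreserving_add_right volume b).quasiMeasurePreserving.ae hdiag))).exists
  have hnorm := congrArg norm hy
  rw [norm_mul, RCLike.norm_conj, Complex.norm_real, Real.norm_of_nonneg (by positivity)] at hnorm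
  have hsq := congrArg₂ (· * ·) hsub hadd
  simp only [← mul_pow, ← hb] at hsq hnorm
  rw [hnorm, mul_pow, mul_pow, ← Real.exp_nat_mul, ← Real.exp_nat_mul, mul_mul_mul_comm, ← sq,
    ← Real.exp_add, mul_assoc, ← Real.exp_add] at hsq
  have hexp := Real.exp_injective (mul_left_cancel₀ (pow_pos hc 2).ne' hsq)
  have hKb : K⁻¹ *ᵥ b = (1 / 2 : ℝ) • u := by
    rw [hb, mulVec_smul, mulVec_mulVec, nonsing_inv_mul _ hK, one_mulVec]
  simp only [mulVec_sub, mulVec_add, hKb, dotProduct_add, dotProduct_sub, add_dotProduct,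
    sub_dotProduct, dotProduct_smul, smul_dotProduct, smul_eq_mul] at hexp
  push_cast at hexp
  linarith

theorem IsGaussianWith.eq_one_of_diagonal {ψ : Hilb ι} {ν : ι → ℝ} (hν : ∀ i, 0 < ν i)
    (h : IsGaussianWith ψ 0 (diagonal (Sum.elim ν ν))) (k : ι) : ν k = 1 := by
  set K : Matrix ι ι ℝ := diagonal fun i => √(ν i) with hKdef
  have hK : IsUnit K.det := by
    rw [hKdef, det_diagonal, isUnit_iff_ne_zero, Finset.prod_ne_zero_iff]
    exact fun i _ => (Real.sqrt_pos.2 (hν i)).ne'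
  have hKK : K * Kᵀ = diagonal ν := by
    rw [hKdef, diagonal_transpose, diagonal_mul_diagonal]
    simp only [Real.mul_self_sqrt (hν _).le]
  rw [← fromBlocks_diagonal, ← hKK] at h
  have hk := h.mulVec_dotProduct_mulVec_mulVec hK (Pi.single k 1)
  rw [hKK, hKdef, diagonal_mulVec_single, diagonal_mulVec_single, single_dotProduct,
    Pi.single_eq_same, mul_one, single_dotProduct, Pi.single_eq_same, mul_left_comm,
    Real.mul_self_sqrt (hν k).le] at hk
  nlinarith [hν k]

theorem IsGaussianWith.isSymplecticSpectrum_one {ψ : Hilb ι} {d : Phase ι}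
    {C : Matrix (ι ⊕ ι) (ι ⊕ ι) ℝ} (h : IsGaussianWith ψ d C) :
    IsSymplecticSpectrum C fun _ => 1 := by
  obtain ⟨ν, hν, S, hS, hSC⟩ := exists_isSymplecticSpectrum h.posDef
  obtain ⟨U, hU⟩ := exists_implements hS (-(S *ᵥ d))
  have hUψ := h.map hU
  rw [add_neg_cancel, hSC] at hUψ
  obtain rfl : ν = fun _ => 1 := funext (hUψ.eq_one_of_diagonal hν)
  exact ⟨hν, S, hS, hSC⟩

theorem IsSymplecticSpectrum.mem_symplecticGroup {C : Matrix (ι ⊕ ι) (ι ⊕ ι) ℝ}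
    (h : IsSymplecticSpectrum C fun _ => 1) : C ∈ symplecticGroup ι ℝ := by
  obtain ⟨-, S, hS, hSC⟩ := h
  rw [Sum.elim_lam_const_lam_const, diagonal_one] at hSC
  have hdet := SymplecticGroup.symplectic_det hS
  have hC : S⁻¹ * (S * C * Sᵀ) * (Sᵀ)⁻¹ = C := by
    rw [Matrix.mul_assoc S, nonsing_inv_mul_cancel_left _ _ hdet,
      mul_nonsing_inv_cancel_right _ _ (by rwa [det_transpose])]
  rw [← hC, hSC]
  exact mul_mem (mul_mem (inv_mem_symplecticGroup hS) (one_mem _))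
    (inv_mem_symplecticGroup (SymplecticGroup.transpose_mem hS))

end Purity

/-! ### Tensor products -/

section TensorMatrix

variable {ι κ : Type*}

/-- The component of a phase space vector in the first subsystem. -/
def fstPhase (ξ : Phase (ι ⊕ κ)) : Phase ι := fun k => ξ (Sum.map Sum.inl Sum.inl k)

/-- The component of a phase space vector in the second subsystem. -/
def sndPhase (ξ : Phase (ι ⊕ κ)) : Phase κ := fun k => ξ (Sum.map Sum.inr Sum.inr k)

/-- The direct sum of two phase space vectors, with the coordinates reordered so that all positions
precede all momenta. -/
def sumVec (s₁ : Phase ι) (s₂ : Phase κ) : Phase (ι ⊕ κ) :=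
  Sum.elim s₁ s₂ ∘ (Equiv.sumSumSumComm ι ι κ κ).symm

/-- The direct sum of two matrices on phase space, with the coordinates reordered as in
`sumVec`. -/
def sumMatrix (S₁ : Matrix (ι ⊕ ι) (ι ⊕ ι) ℝ) (S₂ : Matrix (κ ⊕ κ) (κ ⊕ κ) ℝ) :
    Matrix ((ι ⊕ κ) ⊕ (ι ⊕ κ)) ((ι ⊕ κ) ⊕ (ι ⊕ κ)) ℝ :=
  (fromBlocks S₁ 0 0 S₂).submatrix (Equiv.sumSumSumComm ι ι κ κ).symm
    (Equiv.sumSumSumComm ι ι κ κ).symm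

theorem comp_sumSumSumComm (ξ : Phase (ι ⊕ κ)) :
    ξ ∘ Equiv.sumSumSumComm ι ι κ κ = Sum.elim (fstPhase ξ) (sndPhase ξ) := by
  ext ((i | i) | (i | i)) <;> rfl

theorem sumVec_fstPhase_sndPhase (ξ : Phase (ι ⊕ κ)) : sumVec (fstPhase ξ) (sndPhase ξ) = ξ := by
  ext ((i | i) | (i | i)) <;> rfl

theorem fstPhase_sumVec (s₁ : Phase ι) (s₂ : Phase κ) : fstPhase (sumVec s₁ s₂) = s₁ := by
  ext (i | i) <;> rfl

theorem sndPhase_sumVec (s₁ : Phase ι) (s₂ : Phase κ) : sndPhase (sumVec s₁ s₂) = s₂ := by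
  ext (i | i) <;> rfl

variable [Fintype ι] [Fintype κ]

theorem dotProduct_sumVec (ξ : Phase (ι ⊕ κ)) (s₁ : Phase ι) (s₂ : Phase κ) :
    ξ ⬝ᵥ sumVec s₁ s₂ = fstPhase ξ ⬝ᵥ s₁ + sndPhase ξ ⬝ᵥ s₂ := by
  rw [sumVec, ← comp_equiv_dotProduct_comp_equiv _ _ (Equiv.sumSumSumComm ι ι κ κ),
    comp_sumSumSumComm, Function.comp_assoc, Equiv.symm_comp_self, Function.comp_id,
    sumElim_dotProduct_sumElim]

theorem sumMatrix_transpose_mulVec (S₁ : Matrix (ι ⊕ ι) (ι ⊕ ι) ℝ) (S₂ : Matrix (κ ⊕ κ) (κ ⊕ κ) ℝ)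
    (ξ : Phase (ι ⊕ κ)) :
    (sumMatrix S₁ S₂)ᵀ *ᵥ ξ = sumVec (S₁ᵀ *ᵥ fstPhase ξ) (S₂ᵀ *ᵥ sndPhase ξ) := by
  rw [sumMatrix, transpose_submatrix, submatrix_mulVec_equiv, Equiv.symm_symm, comp_sumSumSumComm,
    fromBlocks_transpose, fromBlocks_mulVec, sumVec]
  simp

theorem trace_sumMatrix_mul_mul_transpose (S₁ : Matrix (ι ⊕ ι) (ι ⊕ ι) ℝ)
    (S₂ : Matrix (κ ⊕ κ) (κ ⊕ κ) ℝ)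
    (C : Matrix ((ι ⊕ κ) ⊕ (ι ⊕ κ)) ((ι ⊕ κ) ⊕ (ι ⊕ κ)) ℝ) :
    (sumMatrix S₁ S₂ * C * (sumMatrix S₁ S₂)ᵀ).trace =
      (S₁ * reducedCov C * S₁ᵀ).trace + (S₂ * reducedCovRight C * S₂ᵀ).trace := by
  set e := Equiv.sumSumSumComm ι ι κ κ
  have hC : C = (fromBlocks (reducedCov C) (correlationBlock C)
      (C.submatrix (Sum.map Sum.inr Sum.inr) (Sum.map Sum.inl Sum.inl))
      (reducedCovRight C)).submatrix e.symm e.symm := by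
    ext ((i | i) | (i | i)) ((j | j) | (j | j)) <;> rfl
  have htrace (M : Matrix ((ι ⊕ ι) ⊕ (κ ⊕ κ)) ((ι ⊕ ι) ⊕ (κ ⊕ κ)) ℝ) :
      (M.submatrix e.symm e.symm).trace = M.trace :=
    e.symm.sum_comp fun i => M i i
  conv_lhs => rw [hC]
  rw [sumMatrix, transpose_submatrix, submatrix_mul_equiv, submatrix_mul_equiv,
    fromBlocks_transpose, fromBlocks_multiply, fromBlocks_multiply, htrace, Matrix.trace,
    Fintype.sum_sum_type]
  simp [Matrix.trace]

end TensorMatrix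

section Tensor

variable {ι κ : Type*} [Fintype ι] [Fintype κ]

theorem coeFn_tensor (f : Hilb ι) (g : Hilb κ) : tensor f g =ᵐ[volume] tensorFun f g :=
  MemLp.coeFn_toLp _

theorem quasiMeasurePreserving_comp_inl :
    Measure.QuasiMeasurePreserving (fun (x : ι ⊕ κ → ℝ) i => x (Sum.inl i)) volume volume :=
  Measure.quasiMeasurePreserving_fst.comp
    (volume_measurePreserving_sumPiEquivProdPi fun _ : ι ⊕ κ => ℝ).quasiMeasurePreserving

theorem quasiMeasurePreserving_comp_inr :
    Measure.QuasiMeasurePreserving (fun (x : ι ⊕ κ → ℝ) j => x (Sum.inr j)) volume volume :=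
  Measure.quasiMeasurePreserving_snd.comp
    (volume_measurePreserving_sumPiEquivProdPi fun _ : ι ⊕ κ => ℝ).quasiMeasurePreserving

theorem tensorFun_congr {f f' : (ι → ℝ) → ℂ} {g g' : (κ → ℝ) → ℂ} (hf : f =ᵐ[volume] f')
    (hg : g =ᵐ[volume] g') : tensorFun f g =ᵐ[volume] tensorFun f' g' := by
  filter_upwards [quasiMeasurePreserving_comp_inl.ae_eq_comp hf,
    quasiMeasurePreserving_comp_inr.ae_eq_comp hg] with x hfx hgx
  simp only [Function.comp_apply] at hfx hgx
  rw [tensorFun, tensorFun, hfx, hgx]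

theorem tensor_smul_smul (a b : ℂ) (f : Hilb ι) (g : Hilb κ) :
    tensor (a • f) (b • g) = (a * b) • tensor f g := by
  apply Lp.ext
  filter_upwards [coeFn_tensor (a • f) (b • g), coeFn_tensor f g,
    Lp.coeFn_smul (a * b) (tensor f g),
    tensorFun_congr (Lp.coeFn_smul a f) (Lp.coeFn_smul b g)] with x hab hfg hsmul hcongr
  rw [hab, hcongr, hsmul, Pi.smul_apply, hfg]
  simp only [tensorFun, Pi.smul_apply, smul_eq_mul]
  ring

theorem inner_tensor (f f' : Hilb ι) (g g' : Hilb κ) :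
    inner ℂ (tensor f g) (tensor f' g') = inner ℂ f f' * inner ℂ g g' := by
  rw [inner_eq_integral, inner_eq_integral, inner_eq_integral, ← integral_prod_mul]
  refine Eq.trans (integral_congr_ae ?_)
    ((volume_measurePreserving_sumPiEquivProdPi fun _ : ι ⊕ κ => ℝ).integral_comp'
      fun z : (ι → ℝ) × (κ → ℝ) =>
        ((starRingEnd ℂ) (f z.1) * f' z.1) * ((starRingEnd ℂ) (g z.2) * g' z.2))
  filter_upwards [coeFn_tensor f g, coeFn_tensor f' g'] with x hx hx'
  rw [hx, hx', tensorFun, tensorFun, map_mul]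
  simp only [MeasurableEquiv.coe_sumPiEquivProdPi, Equiv.sumPiEquivProdPi_apply]
  ring

theorem weyl_tensor (ξ : Phase (ι ⊕ κ)) (f : Hilb ι) (g : Hilb κ) :
    weyl ξ (tensor f g) = tensor (weyl (fstPhase ξ) f) (weyl (sndPhase ξ) g) := by
  apply Lp.ext
  filter_upwards [coeFn_weyl ξ (tensor f g), weylFun_congr ξ (coeFn_tensor f g),
    coeFn_tensor (weyl (fstPhase ξ) f) (weyl (sndPhase ξ) g),
    tensorFun_congr (coeFn_weyl (fstPhase ξ) f) (coeFn_weyl (sndPhase ξ) g)]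
    with x hweyl hweylFun htensor htensorFun
  rw [hweyl, hweylFun, htensor, htensorFun]
  simp only [weylFun, tensorFun]
  rw [mul_mul_mul_comm, ← Complex.exp_add, ← mul_add, ← Complex.ofReal_add]
  congr 4
  simp only [dotProduct, Fintype.sum_sum_type, posPart, momPart, fstPhase, sndPhase, Sum.map_inl,
    Sum.map_inr]
  ring

-- The Weyl orbit of a product of two Gaussian wave functions consists of product vectors.
theorem dense_span_tensor : Dense (Submodule.span ℂ
    (Set.range fun p : Hilb ι × Hilb κ => tensor p.1 p.2) : Set (Hilb (ι ⊕ κ))) := by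
  classical
  have hι : IsUnit (1 : Matrix ι ι ℝ).det := by simp
  have hκ : IsUnit (1 : Matrix κ κ ℝ).det := by simp
  refine (dense_span_weyl (ψ := tensor (gaussVec hι 0) (gaussVec hκ 0)) ?_).mono
    (Submodule.span_mono ?_)
  · filter_upwards [coeFn_tensor (gaussVec hι 0) (gaussVec hκ 0),
      tensorFun_congr (coeFn_gaussVec hι 0) (coeFn_gaussVec hκ 0)] with x htensor htensorFun
    rw [htensor, htensorFun]
    exact mul_ne_zero (Complex.exp_ne_zero _) (Complex.exp_ne_zero _)
  · rintro _ ⟨ξ, rfl⟩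
    exact ⟨(_, _), (weyl_tensor ξ _ _).symm⟩

theorem exists_tensor_linearIsometryEquiv (U₁ : Hilb ι ≃ₗᵢ[ℂ] Hilb ι)
    (U₂ : Hilb κ ≃ₗᵢ[ℂ] Hilb κ) :
    ∃ V : Hilb (ι ⊕ κ) ≃ₗᵢ[ℂ] Hilb (ι ⊕ κ), ∀ f g, V (tensor f g) = tensor (U₁ f) (U₂ g) := by
  have hrange : Set.range (fun p : Hilb ι × Hilb κ => tensor (U₁ p.1) (U₂ p.2)) =
      Set.range fun p : Hilb ι × Hilb κ => tensor p.1 p.2 :=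
    (U₁.surjective.prodMap U₂.surjective).range_comp fun p : Hilb ι × Hilb κ => tensor p.1 p.2
  obtain ⟨V, hV⟩ := exists_linearIsometryEquiv_of_inner_eq
    (v := fun p : Hilb ι × Hilb κ => tensor p.1 p.2) (w := fun p => tensor (U₁ p.1) (U₂ p.2))
    dense_span_tensor (hrange ▸ dense_span_tensor) fun p q => by
      rw [inner_tensor, inner_tensor, U₁.inner_map_map, U₂.inner_map_map]
  exact ⟨V, fun f g => hV (f, g)⟩

theorem Implements.tensor {U₁ : Hilb ι ≃ₗᵢ[ℂ] Hilb ι} {U₂ : Hilb κ ≃ₗᵢ[ℂ] Hilb κ}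
    {V : Hilb (ι ⊕ κ) ≃ₗᵢ[ℂ] Hilb (ι ⊕ κ)} (hV : ∀ f g, V (tensor f g) = tensor (U₁ f) (U₂ g))
    {S₁ : Matrix (ι ⊕ ι) (ι ⊕ ι) ℝ} {S₂ : Matrix (κ ⊕ κ) (κ ⊕ κ) ℝ} {s₁ : Phase ι} {s₂ : Phase κ}
    (h₁ : Implements U₁ S₁ s₁) (h₂ : Implements U₂ S₂ s₂) :
    Implements V (sumMatrix S₁ S₂) (sumVec s₁ s₂) := by
  refine Implements.of_dense_span dense_span_tensor fun ξ p => ?_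
  rw [hV, weyl_tensor, h₁.weyl_map, h₂.weyl_map, tensor_smul_smul, weyl_tensor, hV,
    sumMatrix_transpose_mulVec, fstPhase_sumVec, sndPhase_sumVec, dotProduct_sumVec,
    ← Complex.exp_add, ← mul_add, ← Complex.ofReal_add]

end Tensor

/-! ### Ergotropy -/

section Ergotropy

variable {ι κ : Type*} [Fintype ι] [Fintype κ]

theorem biInf_eq_of_forall_le {α β : Type*} [CompleteLattice β] {f : α → β} {p : α → Prop} {a : α}
    (ha : p a) (h : ∀ b, p b → f a ≤ f b) : ⨅ (b : α) (_ : p b), f b = f a :=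
  le_antisymm (iInf₂_le a ha) (le_iInf₂ h)

variable [DecidableEq ι] [DecidableEq κ]

theorem IsGaussianWith.exists_isGaussianUnitary_minimizer {ψ : Hilb ι} {d : Phase ι}
    {C : Matrix (ι ⊕ ι) (ι ⊕ ι) ℝ} (h : IsGaussianWith ψ d C) {ν : ι → ℝ}
    (hν : IsSymplecticSpectrum C ν) :
    ∃ U : Hilb ι ≃ₗᵢ[ℂ] Hilb ι, IsGaussianUnitary U ∧
      energy (U ψ) = ENNReal.ofReal ((∑ i, ν i) / 2) ∧
      ∀ V : Hilb ι ≃ₗᵢ[ℂ] Hilb ι, IsGaussianUnitary V → energy (U ψ) ≤ energy (V ψ) := by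
  have ⟨_, S, hS, hSC⟩ := hν
  obtain ⟨U, hU⟩ := exists_implements hS (-(S *ᵥ d))
  have hUψ : energy (U ψ) = ENNReal.ofReal ((∑ i, ν i) / 2) := by
    rw [(h.map hU).energy_eq, add_neg_cancel, hSC, trace_diagonal, dotProduct_zero]
    congr 1
    simp only [Fintype.sum_sum_type, Sum.elim_inl, Sum.elim_inr]
    ring
  refine ⟨U, ⟨S, hS, _, hU⟩, hUψ, ?_⟩
  rintro V ⟨T, hT, t, hV⟩
  rw [hUψ, (h.map hV).energy_eq]
  refine ENNReal.ofReal_le_ofReal ?_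
  have hdisplacement : 0 ≤ (T *ᵥ d + t) ⬝ᵥ (T *ᵥ d + t) := dotProduct_self_star_nonneg _
  linarith [two_mul_sum_le_trace_mul_mul_transpose hν hT]

theorem IsGaussianWith.exists_isLocalGaussianUnitary_minimizer {ψ : Hilb (ι ⊕ κ)}
    {d : Phase (ι ⊕ κ)} {C : Matrix ((ι ⊕ κ) ⊕ (ι ⊕ κ)) ((ι ⊕ κ) ⊕ (ι ⊕ κ)) ℝ}
    (h : IsGaussianWith ψ d C) {ν : ι → ℝ} {μ : κ → ℝ}
    (hν : IsSymplecticSpectrum (reducedCov C) ν)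
    (hμ : IsSymplecticSpectrum (reducedCovRight C) μ) :
    ∃ U : Hilb (ι ⊕ κ) ≃ₗᵢ[ℂ] Hilb (ι ⊕ κ), IsLocalGaussianUnitary U ∧
      energy (U ψ) = ENNReal.ofReal ((∑ i, ν i + ∑ j, μ j) / 2) ∧
      ∀ V : Hilb (ι ⊕ κ) ≃ₗᵢ[ℂ] Hilb (ι ⊕ κ),
        IsLocalGaussianUnitary V → energy (U ψ) ≤ energy (V ψ) := by
  have ⟨_, S₁, hS₁, hSC₁⟩ := hν
  have ⟨_, S₂, hS₂, hSC₂⟩ := hμ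
  set s := -(sumMatrix S₁ S₂ *ᵥ d) with hs
  obtain ⟨U₁, hU₁⟩ := exists_implements hS₁ (fstPhase s)
  obtain ⟨U₂, hU₂⟩ := exists_implements hS₂ (sndPhase s)
  obtain ⟨U, hU⟩ := exists_tensor_linearIsometryEquiv U₁ U₂
  have hUψ : energy (U ψ) = ENNReal.ofReal ((∑ i, ν i + ∑ j, μ j) / 2) := by
    rw [(h.map (.tensor hU hU₁ hU₂)).energy_eq, sumVec_fstPhase_sndPhase, hs, add_neg_cancel,
      trace_sumMatrix_mul_mul_transpose, hSC₁, hSC₂, trace_diagonal, trace_diagonal,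
      dotProduct_zero]
    congr 1
    simp only [Fintype.sum_sum_type, Sum.elim_inl, Sum.elim_inr]
    ring
  refine ⟨U, ⟨U₁, U₂, ⟨S₁, hS₁, _, hU₁⟩, ⟨S₂, hS₂, _, hU₂⟩, hU⟩, hUψ, ?_⟩
  rintro V ⟨V₁, V₂, ⟨T₁, hT₁, t₁, hV₁⟩, ⟨T₂, hT₂, t₂, hV₂⟩, hV⟩
  rw [hUψ, (h.map (.tensor hV hV₁ hV₂)).energy_eq, trace_sumMatrix_mul_mul_transpose]
  refine ENNReal.ofReal_le_ofReal ?_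
  have hdisplacement : 0 ≤ (sumMatrix T₁ T₂ *ᵥ d + sumVec t₁ t₂) ⬝ᵥ
      (sumMatrix T₁ T₂ *ᵥ d + sumVec t₁ t₂) := dotProduct_self_star_nonneg _
  linarith [two_mul_sum_le_trace_mul_mul_transpose hν hT₁,
    two_mul_sum_le_trace_mul_mul_transpose hμ hT₂]

theorem IsGaussianWith.ergotropicGap_eq {ψ : Hilb (ι ⊕ κ)} {d : Phase (ι ⊕ κ)}
    {C : Matrix ((ι ⊕ κ) ⊕ (ι ⊕ κ)) ((ι ⊕ κ) ⊕ (ι ⊕ κ)) ℝ} (h : IsGaussianWith ψ d C)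
    {ν : ι → ℝ} (hν : IsSymplecticSpectrum (reducedCov C) ν) :
    ergotropicGap ψ = ∑ i, (ν i - 1) := by
  obtain ⟨μ, hμ⟩ := exists_isSymplecticSpectrum (posDef_reducedCovRight h.posDef)
  obtain ⟨U, hU, hUe, hUmin⟩ := h.exists_isGaussianUnitary_minimizer h.isSymplecticSpectrum_one
  obtain ⟨V, hV, hVe, hVmin⟩ := h.exists_isLocalGaussianUnitary_minimizer hν hμ
  have hsum : ∑ i, (ν i - 1) = ∑ j, (μ j - 1) :=
    sum_sub_one_eq_of_mem_symplecticGroup h.symm h.isSymplecticSpectrum_one.mem_symplecticGroup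
      hν hμ
  have hν₀ : 0 ≤ ∑ i, ν i := Finset.sum_nonneg fun i _ => (hν.1 i).le
  have hμ₀ : 0 ≤ ∑ j, μ j := Finset.sum_nonneg fun j _ => (hμ.1 j).le
  rw [ergotropicGap, globalErgotropy, localErgotropy, biInf_eq_of_forall_le hU hUmin,
    biInf_eq_of_forall_le hV hVmin, hUe, hVe, ENNReal.toReal_ofReal (by positivity),
    ENNReal.toReal_ofReal (by positivity)]
  simp only [Finset.sum_sub_distrib, Finset.sum_const, Finset.card_univ, nsmul_eq_mul, mul_one,
    Fintype.card_sum, Nat.cast_add] at hsum ⊢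
  linarith

end Ergotropy

end CV

end

theorem lemma1_general {ι κ : Type*} [Fintype ι] [DecidableEq ι] [Fintype κ] [DecidableEq κ]
    (ψ : CV.Hilb (ι ⊕ κ)) (hψ : CV.IsPureGaussian ψ) :
    CV.energy ψ ≠ ⊤ ∧
    (∃ U : CV.Hilb (ι ⊕ κ) ≃ₗᵢ[ℂ] CV.Hilb (ι ⊕ κ), CV.IsGaussianUnitary U ∧
      ∀ V : CV.Hilb (ι ⊕ κ) ≃ₗᵢ[ℂ] CV.Hilb (ι ⊕ κ),
        CV.IsGaussianUnitary V → CV.energy (U ψ) ≤ CV.energy (V ψ)) ∧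
    (∃ U : CV.Hilb (ι ⊕ κ) ≃ₗᵢ[ℂ] CV.Hilb (ι ⊕ κ), CV.IsLocalGaussianUnitary U ∧
      ∀ V : CV.Hilb (ι ⊕ κ) ≃ₗᵢ[ℂ] CV.Hilb (ι ⊕ κ),
        CV.IsLocalGaussianUnitary V → CV.energy (U ψ) ≤ CV.energy (V ψ)) ∧
    (∃ ν : ι → ℝ, CV.IsSymplecticSpectrum (CV.reducedCov (CV.covMatrix ψ)) ν) ∧
    ∀ ν : ι → ℝ, CV.IsSymplecticSpectrum (CV.reducedCov (CV.covMatrix ψ)) ν →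
      CV.ergotropicGap ψ = ∑ i, (ν i - 1) := by
  obtain ⟨d, C, h⟩ := hψ.exists_isGaussianWith
  obtain ⟨ν, hν⟩ := CV.exists_isSymplecticSpectrum (CV.posDef_reducedCov h.posDef)
  obtain ⟨μ, hμ⟩ := CV.exists_isSymplecticSpectrum (CV.posDef_reducedCovRight h.posDef)
  obtain ⟨U, hU, -, hUmin⟩ := h.exists_isGaussianUnitary_minimizer h.isSymplecticSpectrum_one
  obtain ⟨V, hV, -, hVmin⟩ := h.exists_isLocalGaussianUnitary_minimizer hν hμ
  have hfinite : CV.energy ψ ≠ ⊤ := h.energy_eq ▸ ENNReal.ofReal_ne_top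
  rw [h.covMatrix_eq]
  exact ⟨hfinite, ⟨U, hU, hUmin⟩, ⟨V, hV, hVmin⟩, ⟨ν, hν⟩, fun _ => h.ergotropicGap_eq⟩

theorem lemma1 (m₁ m₂ : ℕ) (hm : m₁ ≤ m₂)
    (ψ : CV.Hilb (Fin m₁ ⊕ Fin m₂)) (hψ : CV.IsPureGaussian ψ) :
    -- the energy is finite and both minima in the ergotropies are attained
    CV.energy ψ ≠ ⊤ ∧
    (∃ U : CV.Hilb (Fin m₁ ⊕ Fin m₂) ≃ₗᵢ[ℂ] CV.Hilb (Fin m₁ ⊕ Fin m₂),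
      CV.IsGaussianUnitary U ∧
        ∀ V : CV.Hilb (Fin m₁ ⊕ Fin m₂) ≃ₗᵢ[ℂ] CV.Hilb (Fin m₁ ⊕ Fin m₂),
          CV.IsGaussianUnitary V → CV.energy (U ψ) ≤ CV.energy (V ψ)) ∧
    (∃ U : CV.Hilb (Fin m₁ ⊕ Fin m₂) ≃ₗᵢ[ℂ] CV.Hilb (Fin m₁ ⊕ Fin m₂),
      CV.IsLocalGaussianUnitary U ∧
        ∀ V : CV.Hilb (Fin m₁ ⊕ Fin m₂) ≃ₗᵢ[ℂ] CV.Hilb (Fin m₁ ⊕ Fin m₂),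
          CV.IsLocalGaussianUnitary V → CV.energy (U ψ) ≤ CV.energy (V ψ)) ∧
    -- the symplectic eigenvalues exist, and they determine the gap
    (∃ ν : Fin m₁ → ℝ, CV.IsSymplecticSpectrum (CV.reducedCov (CV.covMatrix ψ)) ν) ∧
    ∀ ν : Fin m₁ → ℝ, CV.IsSymplecticSpectrum (CV.reducedCov (CV.covMatrix ψ)) ν →
      CV.ergotropicGap ψ = ∑ i, (ν i - 1) :=
  lemma1_general ψ hψ
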